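/- Let $F$ be a field of characteristic $0$, let $G$ be an abelian group, and let $\Delta$ be a locally finite irreducible root system in a real vector space, with $0\notin\Delta$, root lattice $\langle\Delta\rangle$ and Cartan integers $\langle\nu,\mu\rangle=\mu^\vee(\nu)$, where $\langle 0,\mu\rangle=0$. Put $\Delta^{\mathrm{red}}=\{\alpha\in\Delta\mid \tfrac12\alpha\notin\Delta\}$. A *general locally Lie $G$-torus of type $\Delta$* is a Lie algebra $L$ over $F$ with a decomposition into subspaces $L=\bigoplus_{\mu\in\Delta\cup\{0\},\,g\in G}L_\mu^g$ such that 1. $[L_\mu^g,L_\nu^h]\subset L_{\mu+\nu}^{g+h}$ whenever $\mu,\nu,\mu+\nu\in\Delta\cup\{0\}$ and $g,h\in G$; 2. $L_0^g=\sum_{\mu\in\Delta,\,h\in G}[L_\mu^h,L_{-\mu}^{g-h}]$ for every $g\in G$; 3. for all $\mu\in\Delta$, $g\in G$ and $0\neq x\in L_\mu^g$ there is $y\in L_{-\mu}^{-g}$ such that $[[x,y],z]=\langle\nu,\mu\rangle z$ for all $z\in L_\nu^h$, $\nu\in\Delta\cup\{0\}$, $h\in G$; 4. $G$ is generated by $\operatorname{supp}_G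 L=\{g\in G\mid L_\mu^g\neq0\text{ for some }\mu\in\Delta\cup\{0\}\}$; 5. $\dim L_\mu^g\le 1$ for all $\mu\in\Delta$, $g\in G$; 6. $L_\mu:=\bigoplus_{g\in G}L_\mu^g\neq0$ for all $\mu\in\Delta$. It is *normal* if moreover $\dim L_\mu^0=1$ for all $\mu\in\Delta^{\mathrm{red}}$. Put $L_\mu^g=0$ for $\mu\in\langle\Delta\rangle\setminus(\Delta\cup\{0\})$. For a group homomorphism $s:\langle\Delta\rangle\to G$, the *isotope* $L^{(s)}$ is the Lie algebra $L$ with the new grading $(L^{(s)})_\alpha^g:=L_\alpha^{g+s(\alpha)}$ ($\alpha\in\langle\Delta\rangle$, $g\in G$). If $P$ is the subgroup of $G$ generated by $\operatorname{supp}_G L^{(s)}$ and $L^{(s)}$, regarded as graded by $\langle\Delta\rangle\times P$, is a Lie $P$-torus, then $L$ is said to be *isotopic* to this Lie $P$-torus. **Theorem.** Every general locally Lie $G$-torus of type $\Delta$ is isotopic to a normal locally Lie $P$-torus of type $\Delta$ for some subgroup $P\le G$. That is, there is a homomorphism $s:\langle\Delta\rangle\to G$ such that, with $P$ the subgroup generated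 by $\operatorname{supp}_G L^{(s)}$, the isotope $L^{(s)}$ is a normal locally Lie $P$-torus of type $\Delta$. -/

import Mathlib

/-- A locally finite root system (in the sense of Loos and Neher) in a real vector space `V`,
not necessarily of finite dimension; `0` is not counted as a root. The coroot of `α` is uniquely
determined by the set of roots. -/
structure LocallyFiniteRootSystem (V : Type*) [AddCommGroup V] [Module ℝ V] where
  /-- The set `Δ` of roots. -/
  roots : Set V
  /-- The coroot `α^∨`, a linear form on `V`. -/
  coroot : roots → Module.Dual ℝ V
  zero_notMem : (0 : V) ∉ roots
  span_roots : Submodule.span ℝ roots = ⊤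
  coroot_self : ∀ α : roots, coroot α (α : V) = 2
  reflection_mem : ∀ α β : roots, (β : V) - coroot α (β : V) • (α : V) ∈ roots
  integral : ∀ α β : roots, ∃ n : ℤ, coroot α (β : V) = (n : ℝ)
  locallyFinite : ∀ U : Submodule ℝ V, FiniteDimensional ℝ U → (roots ∩ (U : Set V)).Finite

namespace LocallyFiniteRootSystem

variable {V : Type*} [AddCommGroup V] [Module ℝ V] (R : LocallyFiniteRootSystem V)

/-- The root system is nonempty and is not the union of two nonempty subsets orthogonal to
each other. -/
def IsIrreducible : Prop :=
  R.roots.Nonempty ∧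
    ∀ A : Set R.roots, A.Nonempty → Aᶜ.Nonempty → ∃ α ∈ A, ∃ β ∈ Aᶜ, R.coroot α (β : V) ≠ 0

/-- The set `Δ^red` of the roots `α` such that `α / 2` is not a root. -/
def redRoots : Set V := {α | α ∈ R.roots ∧ (2⁻¹ : ℝ) • α ∉ R.roots}

/-- The root lattice `⟨Δ⟩`, the subgroup of `V` generated by the roots. -/
abbrev rootLattice : AddSubgroup V := AddSubgroup.closure R.roots

theorem integral_rootLattice (μ : R.roots) (ν : R.rootLattice) :
    ∃ n : ℤ, R.coroot μ (ν : V) = (n : ℝ) := by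
  obtain ⟨v, hv⟩ := ν
  induction hv using AddSubgroup.closure_induction with
  | mem x hx => exact R.integral μ ⟨x, hx⟩
  | zero => exact ⟨0, by simp⟩
  | add x y hx hy ihx ihy =>
    obtain ⟨a, ha⟩ := ihx
    obtain ⟨b, hb⟩ := ihy
    refine ⟨a + b, ?_⟩
    simp only at ha hb ⊢
    rw [map_add, ha, hb, Int.cast_add]
  | neg x hx ih =>
    obtain ⟨a, ha⟩ := ih
    refine ⟨-a, ?_⟩
    simp only at ha ⊢
    rw [map_neg, ha, Int.cast_neg]

/-- The Cartan integer `⟨ν, μ⟩ = μ^∨(ν)`; it equals `2 (ν, μ) / (μ, μ)` for every inner product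
on `V` that is invariant under the reflections. -/
noncomputable def cartanInt (ν : R.rootLattice) (μ : R.roots) : ℤ :=
  (R.integral_rootLattice μ ν).choose

theorem cartanInt_cast (ν : R.rootLattice) (μ : R.roots) :
    (R.cartanInt ν μ : ℝ) = R.coroot μ (ν : V) :=
  (R.integral_rootLattice μ ν).choose_spec.symm

end LocallyFiniteRootSystem

section LieTorus

variable {F : Type*} [Field F] {V : Type*} [AddCommGroup V] [Module ℝ V]
  {G : Type*} [AddCommGroup G] {L : Type*} [LieRing L] [LieAlgebra F L]

/-- The support `supp_G 𝓛`, for a family of subspaces `𝓛 μ g` of `L` indexed by the root lattice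
and by `G`. -/
def suppG {R : LocallyFiniteRootSystem V} (𝓛 : R.rootLattice → G → Submodule F L) : Set G :=
  {g | ∃ μ, 𝓛 μ g ≠ ⊥}

/-- The family `𝓛`, where `𝓛 μ g` stands for `L_μ^g`, makes the Lie algebra `L` a general locally
Lie `G`-torus of type `Δ`. The components are indexed by all `μ` in the root lattice, and vanish
unless `μ ∈ Δ ∪ {0}`. -/
structure IsGeneralLieTorus (R : LocallyFiniteRootSystem V)
    (𝓛 : R.rootLattice → G → Submodule F L) : Prop where
  /-- Components outside `Δ ∪ {0}` are zero. -/
  eq_bot : ∀ (μ : R.rootLattice) (g : G), (μ : V) ∉ R.roots → μ ≠ 0 → 𝓛 μ g = ⊥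
  /-- (LT1), the direct sum decomposition. -/
  isInternal : open scoped Classical in
    DirectSum.IsInternal (fun p : R.rootLattice × G => 𝓛 p.1 p.2)
  /-- (LT1), compatibility with the bracket. -/
  lie_mem : ∀ μ ν : R.rootLattice, ((μ : V) ∈ R.roots ∨ μ = 0) → ((ν : V) ∈ R.roots ∨ ν = 0) →
    (((μ + ν : R.rootLattice) : V) ∈ R.roots ∨ μ + ν = 0) →
    ∀ (g h : G), ∀ x ∈ 𝓛 μ g, ∀ y ∈ 𝓛 ν h, ⁅x, y⁆ ∈ 𝓛 (μ + ν) (g + h)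
  /-- (LT2). -/
  zero_eq : ∀ g : G, 𝓛 0 g =
    ⨆ (μ : R.rootLattice) (_ : (μ : V) ∈ R.roots) (h : G),
      Submodule.span F {z : L | ∃ x ∈ 𝓛 μ h, ∃ y ∈ 𝓛 (-μ) (g - h), ⁅x, y⁆ = z}
  /-- (LT3). -/
  division : ∀ (μ : R.rootLattice) (hμ : (μ : V) ∈ R.roots) (g : G), ∀ x ∈ 𝓛 μ g, x ≠ 0 →
    ∃ y ∈ 𝓛 (-μ) (-g), ∀ ν : R.rootLattice, ((ν : V) ∈ R.roots ∨ ν = 0) →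
      ∀ (h : G), ∀ z ∈ 𝓛 ν h, ⁅⁅x, y⁆, z⁆ = R.cartanInt ν ⟨(μ : V), hμ⟩ • z
  /-- (LT4). -/
  closure_suppG : AddSubgroup.closure (suppG 𝓛) = ⊤
  /-- (LT5). -/
  rank_le_one : ∀ (μ : R.rootLattice), (μ : V) ∈ R.roots → ∀ g : G, Module.rank F (𝓛 μ g) ≤ 1
  /-- (LT6)': `L_μ ≠ 0` for all roots `μ`. -/
  ne_bot : ∀ (μ : R.rootLattice), (μ : V) ∈ R.roots → (⨆ g : G, 𝓛 μ g) ≠ ⊥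

/-- A normal locally Lie `G`-torus of type `Δ` satisfies (LT1)-(LT5), (LT6)' and (LT6). -/
structure IsNormalLieTorus (R : LocallyFiniteRootSystem V)
    (𝓛 : R.rootLattice → G → Submodule F L) : Prop extends IsGeneralLieTorus R 𝓛 where
  /-- (LT6). -/
  rank_zero_eq_one : ∀ (μ : R.rootLattice), (μ : V) ∈ R.redRoots → Module.rank F (𝓛 μ 0) = 1

/-- The isotope `L^(s)` of a graded Lie algebra: the same Lie algebra `L`, with the grading
`(L^(s))_α^g = L_α^(g + s(α))`. -/
def isotope {R : LocallyFiniteRootSystem V} (𝓛 : R.rootLattice → G → Submodule F L)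
    (s : R.rootLattice →+ G) : R.rootLattice → G → Submodule F L :=
  fun α g => 𝓛 α (g + s α)

/-- `L`, graded by `𝓛`, is isotopic to the same Lie algebra with the `⟨Δ⟩ × P`-grading `𝓛'`:
for some homomorphism `s : ⟨Δ⟩ → G`, the group `P` is the subgroup of `G` generated by
`supp_G L^(s)`, and `𝓛'` is the isotope `L^(s)` viewed as graded by `⟨Δ⟩ × P`. -/
def IsIsotopicTo {R : LocallyFiniteRootSystem V} (𝓛 : R.rootLattice → G → Submodule F L)
    (P : AddSubgroup G) (𝓛' : R.rootLattice → P → Submodule F L) : Prop :=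
  ∃ s : R.rootLattice →+ G, P = AddSubgroup.closure (suppG (isotope 𝓛 s)) ∧
    ∀ (α : R.rootLattice) (p : P), 𝓛' α p = isotope 𝓛 s α (p : G)

end LieTorus

/-! It suffices to find `s` with `L_μ^(s μ) ≠ 0` for every reduced root `μ`: by (LT5) this component
is a line, it has degree zero in the isotope, and the isotope, graded by the group its support
generates, still satisfies the axioms (`isotope_closure`).

Nonvanishing propagates under reflections. By (LT3) a nonzero `x` in `L_μ^g` lies in an
`sl₂`-triple, which acts locally nilpotently since root strings are finite; hence `L_ν^h ≠ 0` forces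
a nonzero component of degree `h - ⟨ν, μ⟩ g` at the reflected weight (`reflection_ne_bot`). As `s`
is additive, the roots `v` with `L_v^(s v) ≠ 0` are closed under reflecting one in another. So one
needs a set `B` of reduced roots which generates all reduced roots by reflections and on which `s`
can be prescribed freely; if `B` is also linearly independent, it is a ℤ-basis of the root lattice.
This is `IsReflectableBase` for `U = ⊤`.

The rank may be any infinite cardinal, so `B` is not taken from a system of simple roots. The engine
is `exists_extend`: a base of `U` extends to `U'` if `U` is the kernel in `U'` of a linear form with
a least positive value on roots. For finitely many roots this is iterated. Otherwise a Ramsey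
argument produces an infinite simplex, a set of vectors whose differences are roots of one length
(type A). A maximal simplex defines coordinates in which the roots look like those of the classical
systems (`root_cases`). The reduced roots with coordinate sum zero are the differences of vertices
and have an evident base; the coordinate sum is integral on roots, so at most one extension remains.

Lengths and angles refer to an invariant inner product, which is constructed from the coroots
(`exists_invariantForm`). -/

namespace LocallyFiniteRootSystem

variable {V : Type*} [AddCommGroup V] [Module ℝ V] (R : LocallyFiniteRootSystem V)

/-! ### The invariant inner product. -/

/-- The roots in the span of a finite set of vectors. -/
noncomputable def rootsIn (S : Finset V) : Finset V :=
  (R.locallyFinite (Submodule.span ℝ (S : Set V)) inferInstance).toFinset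

theorem mem_rootsIn {S : Finset V} {v : V} :
    v ∈ R.rootsIn S ↔ v ∈ R.roots ∧ v ∈ Submodule.span ℝ (S : Set V) := by
  simp [rootsIn]

/-- The bilinear form `(φ, ψ) ↦ ∑ φ(v) ψ(v)` on the dual space, the sum running over the roots `v`
in the span of `S`. -/
noncomputable def dualForm (S : Finset V) (φ ψ : Module.Dual ℝ V) : ℝ :=
  ∑ v ∈ R.rootsIn S, φ v * ψ v

theorem dualForm_comm (S : Finset V) (φ ψ : Module.Dual ℝ V) :
    R.dualForm S φ ψ = R.dualForm S ψ φ :=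
  Finset.sum_congr rfl fun _ _ => mul_comm _ _

/-- The reflection in `α` permutes the roots in the span of `S` and changes the sign of `α^∨`.
Reindexing the sum by it yields its negative plus the term on the right. -/
theorem two_mul_dualForm_coroot {S : Finset V} (α : R.roots)
    (hα : (α : V) ∈ Submodule.span ℝ (S : Set V)) (φ : Module.Dual ℝ V) :
    2 * R.dualForm S (R.coroot α) φ = R.dualForm S (R.coroot α) (R.coroot α) * φ α := by
  have hmem : ∀ v ∈ R.rootsIn S, v - R.coroot α v • (α : V) ∈ R.rootsIn S := by
    intro v hv
    rw [mem_rootsIn] at hv ⊢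
    exact ⟨R.reflection_mem α ⟨v, hv.1⟩, Submodule.sub_mem _ hv.2 (Submodule.smul_mem _ _ hα)⟩
  have hinv : ∀ v : V, (v - R.coroot α v • (α : V)) -
      R.coroot α (v - R.coroot α v • (α : V)) • (α : V) = v := by
    intro v
    rw [map_sub, map_smul, R.coroot_self, smul_eq_mul]
    module
  have key : R.dualForm S (R.coroot α) φ = ∑ v ∈ R.rootsIn S,
      R.coroot α (v - R.coroot α v • (α : V)) * φ (v - R.coroot α v • (α : V)) :=
    (Finset.sum_nbij' (fun v => v - R.coroot α v • (α : V)) (fun v => v - R.coroot α v • (α : V))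
      hmem hmem (fun v _ => hinv v) (fun v _ => hinv v) (fun v _ => rfl)).symm
  have h2 : R.dualForm S (R.coroot α) φ = - R.dualForm S (R.coroot α) φ +
      R.dualForm S (R.coroot α) (R.coroot α) * φ α := by
    conv_lhs => rw [key]
    unfold dualForm
    rw [Finset.sum_mul, ← Finset.sum_neg_distrib, ← Finset.sum_add_distrib]
    refine Finset.sum_congr rfl fun v _ => ?_
    simp only [map_sub, map_smul, R.coroot_self, smul_eq_mul]
    ring
  linarith

theorem dualForm_coroot_self_pos {S : Finset V} (α : R.roots)
    (hα : (α : V) ∈ Submodule.span ℝ (S : Set V)) :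
    0 < R.dualForm S (R.coroot α) (R.coroot α) := by
  refine Finset.sum_pos' (fun v _ => mul_self_nonneg _)
    ⟨α, R.mem_rootsIn.2 ⟨α.2, hα⟩, ?_⟩
  rw [R.coroot_self]; norm_num

/-- A positive definite symmetric bilinear form which is invariant under the reflections. -/
structure InvariantForm where
  /-- The underlying bilinear form. -/
  form : V →ₗ[ℝ] V →ₗ[ℝ] ℝ
  symm : ∀ x y, form x y = form y x
  pos : ∀ x, x ≠ 0 → 0 < form x x
  coroot_mul : ∀ (α : R.roots) (x : V), R.coroot α x * form α α = 2 * form α x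

variable {R}

-- The norm of a coroot varies with `S`, but ratios stabilise: for nonorthogonal roots,
-- `two_mul_dualForm_coroot` applied both ways expresses the ratio by Cartan integers.
-- Irreducibility extends this to all roots.
open Filter in
theorem IsIrreducible.exists_rootNorm (hR : R.IsIrreducible) (α₀ : R.roots) (β : R.roots) :
    ∃ c : ℝ, 0 < c ∧ ∀ᶠ S : Finset V in atTop,
      c * R.dualForm S (R.coroot β) (R.coroot β) =
        R.dualForm S (R.coroot α₀) (R.coroot α₀) := by
  classical
  have hev : ∀ α : R.roots, ∀ᶠ S : Finset V in atTop, (α : V) ∈ Submodule.span ℝ (S : Set V) := by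
    intro α
    filter_upwards [eventually_ge_atTop {(α : V)}] with S hS
    exact Submodule.subset_span (hS (Finset.mem_singleton_self _))
  by_contra hβ
  obtain ⟨α, ⟨c, hc, hα⟩, γ, hγ, hne⟩ := hR.2 {β | ∃ c : ℝ, 0 < c ∧ ∀ᶠ S : Finset V in atTop,
      c * R.dualForm S (R.coroot β) (R.coroot β) = R.dualForm S (R.coroot α₀) (R.coroot α₀)}
    ⟨α₀, 1, one_pos, by simp⟩ ⟨β, hβ⟩
  apply hγ
  have hrel : ∀ S : Finset V, (α : V) ∈ Submodule.span ℝ (S : Set V) →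
      (γ : V) ∈ Submodule.span ℝ (S : Set V) →
      R.dualForm S (R.coroot α) (R.coroot α) * R.coroot γ α =
      R.dualForm S (R.coroot γ) (R.coroot γ) * R.coroot α γ := by
    intro S h1 h2
    rw [← R.two_mul_dualForm_coroot α h1, ← R.two_mul_dualForm_coroot γ h2, R.dualForm_comm]
  obtain ⟨S, h1, h2⟩ := ((hev α).and (hev γ)).exists
  have p1 := R.dualForm_coroot_self_pos α h1
  have p2 := R.dualForm_coroot_self_pos γ h2
  have h := hrel S h1 h2
  have hpos : 0 < R.coroot α γ / R.coroot γ α := by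
    have hne' : R.coroot γ α ≠ 0 := by
      intro h0
      rw [h0, mul_zero] at h
      exact (mul_ne_zero p2.ne' hne) h.symm
    have : R.coroot α γ / R.coroot γ α = R.dualForm S (R.coroot α) (R.coroot α) /
      R.dualForm S (R.coroot γ) (R.coroot γ) := by
      rw [div_eq_div_iff hne' p2.ne']; linarith
    rw [this]; positivity
  have hne' : R.coroot γ α ≠ 0 := by
    intro h0
    simp [h0] at hpos
  refine ⟨c * (R.coroot α γ / R.coroot γ α), mul_pos hc hpos, ?_⟩
  filter_upwards [hev α, hev γ, hα] with T t1 t2 t3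
  rw [← t3]
  have := hrel T t1 t2
  field_simp
  linarith

-- The form is forced to be `B(α) = (q α / 2) α^∨`, with `q α` the squared length of `α` relative to
-- `α₀`. Symmetry on roots makes `B` well defined on linear combinations. By `hBS`, for large `S`,
-- `B` is up to a positive factor the pullback of `dualForm` along `B` itself, which gives symmetry
-- and positivity.
open Filter in
theorem IsIrreducible.exists_invariantForm (hR : R.IsIrreducible) : Nonempty R.InvariantForm := by
  classical
  obtain ⟨a, ha⟩ := hR.1
  let α₀ : R.roots := ⟨a, ha⟩
  choose q hq hqS using hR.exists_rootNorm α₀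
  have hev : ∀ α : R.roots, ∀ᶠ S : Finset V in atTop, (α : V) ∈ Submodule.span ℝ (S : Set V) := by
    intro α
    filter_upwards [eventually_ge_atTop {(α : V)}] with S hS
    exact Submodule.subset_span (hS (Finset.mem_singleton_self _))
  have hsymm : ∀ α β : R.roots, q α * R.coroot α β = q β * R.coroot β α := by
    intro α β
    obtain ⟨S, h1, h2, h3, h4⟩ :=
      ((hev α).and ((hev β).and ((hqS α).and (hqS β)))).exists
    have p1 := R.dualForm_coroot_self_pos α h1
    have p2 := R.dualForm_coroot_self_pos β h2
    have h : R.dualForm S (R.coroot α) (R.coroot α) * R.coroot β α =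
        R.dualForm S (R.coroot β) (R.coroot β) * R.coroot α β := by
      rw [← R.two_mul_dualForm_coroot α h1, ← R.two_mul_dualForm_coroot β h2, R.dualForm_comm]
    have e : (q α * R.dualForm S (R.coroot α) (R.coroot α)) * (q β * R.coroot β α) =
        (q β * R.dualForm S (R.coroot β) (R.coroot β)) * (q α * R.coroot α β) := by
      linear_combination (q α * q β) * h
    rw [h3, h4] at e
    exact (mul_left_cancel₀ (by rw [← h3]; exact (mul_pos (hq α) p1).ne') e).symm
  let π : (R.roots →₀ ℝ) →ₗ[ℝ] V := Finsupp.linearCombination ℝ (Subtype.val : R.roots → V)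
  let Φ : (R.roots →₀ ℝ) →ₗ[ℝ] Module.Dual ℝ V :=
    Finsupp.linearCombination ℝ (fun α : R.roots => (q α / 2) • R.coroot α)
  have hπ : Function.Surjective π := by
    rw [← LinearMap.range_eq_top, Finsupp.range_linearCombination, Subtype.range_coe]
    exact R.span_roots
  have hΦβ : ∀ (c : R.roots →₀ ℝ) (β : R.roots), Φ c β = q β / 2 * R.coroot β (π c) := by
    intro c β
    induction c using Finsupp.induction_linear with
    | zero => simp
    | add f g hf hg => rw [map_add, LinearMap.add_apply, hf, hg, map_add, map_add]; ring
    | single α r =>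
      simp only [Φ, π, Finsupp.linearCombination_single, LinearMap.smul_apply, map_smul,
        smul_eq_mul]
      linear_combination (r / 2) * hsymm α β
  have hker : ∀ c, π c = 0 → Φ c = 0 := by
    intro c hc
    apply LinearMap.ext_on R.span_roots
    intro v hv
    rw [hΦβ c ⟨v, hv⟩, hc]; simp
  obtain ⟨g, hg⟩ := π.exists_rightInverse_of_surjective (LinearMap.range_eq_top.2 hπ)
  have hg' : ∀ x, π (g x) = x := fun x => LinearMap.congr_fun hg x
  let B : V →ₗ[ℝ] V →ₗ[ℝ] ℝ := Φ.comp g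
  have hB : ∀ c, B (π c) = Φ c := by
    intro c
    have := hker (g (π c) - c) (by rw [map_sub, hg', sub_self])
    rw [map_sub, sub_eq_zero] at this
    exact this
  have hBα : ∀ α : R.roots, B α = (q α / 2) • R.coroot α := by
    intro α
    have := hB (Finsupp.single α 1)
    simpa [π, Φ] using this
  have hBq : ∀ α : R.roots, B α α = q α := by
    intro α
    rw [hBα, LinearMap.smul_apply, R.coroot_self, smul_eq_mul]; ring
  have hBS : ∀ x, ∀ᶠ S : Finset V in atTop, ∀ φ : Module.Dual ℝ V,
      4 * R.dualForm S (B x) φ = R.dualForm S (R.coroot α₀) (R.coroot α₀) * φ x := by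
    intro x
    have hx : x ∈ Submodule.span ℝ R.roots := R.span_roots ▸ Submodule.mem_top
    induction hx using Submodule.span_induction with
    | mem v hv =>
      filter_upwards [hev ⟨v, hv⟩, hqS ⟨v, hv⟩] with S h1 h2 φ
      have h3 := R.two_mul_dualForm_coroot ⟨v, hv⟩ h1 φ
      have h4 : R.dualForm S (B v) φ = q ⟨v, hv⟩ / 2 * R.dualForm S (R.coroot ⟨v, hv⟩) φ := by
        unfold dualForm
        rw [hBα ⟨v, hv⟩, Finset.mul_sum]
        exact Finset.sum_congr rfl fun w _ => by simp [mul_assoc]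
      rw [h4, ← h2]
      linear_combination q ⟨v, hv⟩ * h3
    | zero => simp [dualForm]
    | add x y _ _ hx hy =>
      filter_upwards [hx, hy] with S h1 h2 φ
      have : R.dualForm S (B (x + y)) φ = R.dualForm S (B x) φ + R.dualForm S (B y) φ := by
        simp only [dualForm, map_add, LinearMap.add_apply, add_mul, Finset.sum_add_distrib]
      rw [this, mul_add, h1, h2, map_add]; ring
    | smul r x _ hx =>
      filter_upwards [hx] with S h1 φ
      have : R.dualForm S (B (r • x)) φ = r * R.dualForm S (B x) φ := by
        simp only [dualForm, map_smul, LinearMap.smul_apply, smul_eq_mul, Finset.mul_sum, mul_assoc]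
      rw [this, map_smul, smul_eq_mul]
      linear_combination r * h1 φ
  refine ⟨⟨B, ?_, ?_, ?_⟩⟩
  · intro x y
    obtain ⟨S, h1, h2, h3⟩ := ((hev α₀).and ((hBS x).and (hBS y))).exists
    have p := R.dualForm_coroot_self_pos α₀ h1
    have e1 := h2 (B y)
    have e2 := h3 (B x)
    rw [R.dualForm_comm] at e2
    exact mul_left_cancel₀ p.ne' (e2.symm.trans e1)
  · intro x hx
    obtain ⟨S, h1, h2⟩ := ((hev α₀).and (hBS x)).exists
    have p := R.dualForm_coroot_self_pos α₀ h1
    have hnn : 0 ≤ R.dualForm S (B x) (B x) := Finset.sum_nonneg fun v _ => mul_self_nonneg _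
    have e := h2 (B x)
    by_contra hneg
    have h0 : R.dualForm S (B x) (B x) = 0 := by nlinarith
    have hv : ∀ v ∈ R.rootsIn S, B x v = 0 := fun v hv => by
      have := (Finset.sum_eq_zero_iff_of_nonneg fun v _ => mul_self_nonneg _).1 h0 v hv
      exact mul_self_eq_zero.1 this
    apply hx
    refine (Module.forall_dual_apply_eq_zero_iff ℝ x).1 fun φ => ?_
    have e := h2 φ
    have : R.dualForm S (B x) φ = 0 := Finset.sum_eq_zero fun v h => by rw [hv v h, zero_mul]
    rw [this, mul_zero] at e
    exact (mul_eq_zero.1 e.symm).resolve_left p.ne'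
  · intro α x
    rw [hBq, hBα, LinearMap.smul_apply, smul_eq_mul]; ring

/-! ### Reflections, Cartan integers and root lengths. -/

theorem ne_zero (α : R.roots) : (α : V) ≠ 0 := fun h => R.zero_notMem (h ▸ α.2)

theorem neg_mem {v : V} (hv : v ∈ R.roots) : -v ∈ R.roots := by
  have := R.reflection_mem ⟨v, hv⟩ ⟨v, hv⟩
  rw [R.coroot_self] at this
  convert this using 1
  module

/-- A set of vectors which contains with two roots the reflection of the one in the other. -/
def IsReflClosed (R : LocallyFiniteRootSystem V) (T : Set V) : Prop :=
  ∀ α β : R.roots, (α : V) ∈ T → (β : V) ∈ T → (β : V) - R.coroot α β • (α : V) ∈ T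

theorem IsReflClosed.neg_mem {T : Set V} (hT : R.IsReflClosed T) {v : V} (hv : v ∈ R.roots)
    (h : v ∈ T) : -v ∈ T := by
  have := hT ⟨v, hv⟩ ⟨v, hv⟩ h h
  rw [R.coroot_self] at this
  convert this using 1
  module

theorem reflection_reflection (α : R.roots) (v : V) :
    (v - R.coroot α v • (α : V)) - R.coroot α (v - R.coroot α v • (α : V)) • (α : V) = v := by
  rw [map_sub, map_smul, R.coroot_self, smul_eq_mul]
  module

theorem reflection_mem_redRoots (α : R.roots) {v : V} (hv : v ∈ R.redRoots) :
    v - R.coroot α v • (α : V) ∈ R.redRoots := by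
  refine ⟨R.reflection_mem α ⟨v, hv.1⟩, fun h => hv.2 ?_⟩
  have := R.reflection_mem α ⟨_, h⟩
  have e := congrArg (fun w => (2⁻¹ : ℝ) • w) (R.reflection_reflection α v)
  simp only [map_smul, smul_eq_mul] at this e
  rw [← e]
  convert this using 1
  module

namespace InvariantForm

variable (b : R.InvariantForm)

theorem form_pos (α : R.roots) : 0 < b.form α α := b.pos _ (ne_zero α)

theorem nonneg (x : V) : 0 ≤ b.form x x := by
  by_cases h : x = 0
  · simp [h]
  · exact (b.pos x h).le

theorem eq_zero_of_form_self {x : V} (h : b.form x x = 0) : x = 0 := by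
  by_contra hx
  exact (b.pos x hx).ne' h

theorem sq_le (x y : V) : b.form x y ^ 2 ≤ b.form x x * b.form y y := by
  by_cases hx : x = 0
  · simp [hx]
  have h := b.nonneg (b.form x x • y - b.form x y • x)
  have p := b.pos x hx
  simp only [map_sub, map_smul, LinearMap.sub_apply, LinearMap.smul_apply, smul_eq_mul,
    b.symm y x] at h
  have : 0 ≤ b.form x x * (b.form x x * b.form y y - b.form x y ^ 2) := by linarith
  have := nonneg_of_mul_nonneg_right this p
  linarith

theorem eq_smul_of_sq_eq {x y : V} (hx : x ≠ 0)
    (h : b.form x y ^ 2 = b.form x x * b.form y y) :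
    y = (b.form x y / b.form x x) • x := by
  have p := b.pos x hx
  rw [← sub_eq_zero]
  apply b.eq_zero_of_form_self
  simp only [map_sub, map_smul, LinearMap.sub_apply, LinearMap.smul_apply, smul_eq_mul,
    b.symm y x]
  field_simp
  linarith

theorem form_reflection (α : R.roots) (x y : V) :
    b.form (x - R.coroot α x • (α : V)) (y - R.coroot α y • (α : V)) = b.form x y := by
  simp only [map_sub, map_smul, LinearMap.sub_apply, LinearMap.smul_apply, smul_eq_mul,
    b.symm x α]
  linear_combination (R.coroot α x / 2) * b.coroot_mul α y + (R.coroot α y / 2) * b.coroot_mul α x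

theorem coroot_eq (α : R.roots) (x : V) : R.coroot α x = 2 * b.form α x / b.form α α := by
  rw [eq_div_iff (b.form_pos α).ne', b.coroot_mul]

theorem coroot_pos {α : R.roots} {x : V} (h : 0 < b.form α x) : 0 < R.coroot α x := by
  rw [b.coroot_eq]
  have := b.form_pos α
  positivity

/-- The Cartan integers of two roots: their product is at most `4`, and it is `4` only if the roots
are proportional. -/
theorem exists_cartan {α β : R.roots} (h : 0 < b.form α β) :
    ∃ m n : ℤ, 0 < m ∧ 0 < n ∧ R.coroot α β = m ∧ R.coroot β α = n ∧ m * n ≤ 4 ∧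
      (m : ℝ) * b.form α α = 2 * b.form α β ∧ (n : ℝ) * b.form β β = 2 * b.form α β ∧
      (m * n = 4 → (β : V) = ((m : ℝ) / 2) • (α : V)) := by
  obtain ⟨m, hm⟩ := R.integral α β
  obtain ⟨n, hn⟩ := R.integral β α
  have h1 := b.coroot_mul α β
  have h2 := b.coroot_mul β α
  rw [hm] at h1
  rw [hn, b.symm β α] at h2
  have pa := b.form_pos α
  have pb := b.form_pos β
  have hm0 : (0 : ℝ) < m := by
    rw [← hm]; exact b.coroot_pos h
  have hn0 : (0 : ℝ) < n := by
    rw [← hn]; exact b.coroot_pos (by rwa [b.symm])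
  have hmul : ((m * n : ℤ) : ℝ) * (b.form α α * b.form β β) = 4 * b.form α β ^ 2 := by
    push_cast
    linear_combination (n * b.form β β) * h1 + 2 * b.form α β * h2
  have hcs := b.sq_le (α : V) β
  have pab := mul_pos pa pb
  refine ⟨m, n, by exact_mod_cast hm0, by exact_mod_cast hn0, hm, hn, ?_, h1, h2, ?_⟩
  · have : ((m * n : ℤ) : ℝ) ≤ 4 := by
      by_contra hlt
      push Not at hlt
      nlinarith
    exact_mod_cast this
  · intro h4
    rw [h4] at hmul
    push_cast at hmul
    have e := b.eq_smul_of_sq_eq (ne_zero α) (by linarith : b.form (α : V) β ^ 2 = _)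
    have e2 : b.form (α : V) β / b.form (α : V) α = m / 2 := by
      rw [div_eq_div_iff pa.ne' two_ne_zero]; linarith
    rwa [e2] at e

/-- A Cartan integer `1` makes the difference a reflected root up to sign. If neither is `1`, then
both are `2` and the roots coincide. -/
theorem sub_mem_roots {α β : V} (hα : α ∈ R.roots) (hβ : β ∈ R.roots) (h : 0 < b.form α β)
    (hne : α ≠ β) : α - β ∈ R.roots := by
  obtain ⟨m, n, hm, hn, hm', hn', hmn, -, -, h4⟩ := b.exists_cartan (α := ⟨α, hα⟩) (β := ⟨β, hβ⟩) h
  have ra := R.reflection_mem ⟨α, hα⟩ ⟨β, hβ⟩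
  have rb := R.reflection_mem ⟨β, hβ⟩ ⟨α, hα⟩
  by_cases h1 : m = 1
  · rw [hm', h1] at ra
    have := neg_mem ra
    simpa using this
  by_cases h2 : n = 1
  · rw [hn', h2] at rb
    simpa using rb
  exfalso
  have hm2 : m = 2 := by nlinarith [show 2 ≤ m by omega, show 2 ≤ n by omega]
  have hn2 : n = 2 := by nlinarith [show 2 ≤ m by omega, show 2 ≤ n by omega]
  subst hm2 hn2
  have := h4 rfl
  apply hne
  simpa using this.symm

theorem form_eq_zero_iff_coroot (α : R.roots) (x : V) : R.coroot α x = 0 ↔ b.form α x = 0 := by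
  rw [b.coroot_eq, div_eq_zero_iff]
  simp [(b.form_pos α).ne']

/-- A path `α, γ, β', δ` of successively nonorthogonal roots without shortcut is shortened by
replacing the two middle roots by the reflection of `β'` in `γ`; so distances in this graph are at
most two. -/
theorem exists_nonorthogonal_both (hR : R.IsIrreducible) (α β : R.roots) :
    ∃ γ : R.roots, b.form α γ ≠ 0 ∧ b.form γ β ≠ 0 := by
  by_contra hβ
  obtain ⟨β', ⟨γ, h1, h2⟩, δ, hδ, hne⟩ :=
    hR.2 {β | ∃ γ : R.roots, b.form α γ ≠ 0 ∧ b.form γ β ≠ 0}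
      ⟨α, α, (b.form_pos α).ne', (b.form_pos α).ne'⟩ ⟨β, hβ⟩
  apply hδ
  replace hne : b.form (β' : V) δ ≠ 0 := fun h => hne ((b.form_eq_zero_iff_coroot _ _).2 h)
  by_cases h3 : b.form (α : V) β' = 0
  · by_cases h4 : b.form (γ : V) δ = 0
    · refine ⟨⟨_, R.reflection_mem γ β'⟩, ?_, ?_⟩
      · simp only [map_sub, map_smul, smul_eq_mul, h3, zero_sub, neg_ne_zero]
        exact mul_ne_zero (fun h => h2 ((b.form_eq_zero_iff_coroot _ _).1 h)) h1
      · simpa only [map_sub, map_smul, LinearMap.sub_apply, LinearMap.smul_apply, h4, smul_zero,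
          sub_zero]
    · exact ⟨γ, h1, h4⟩
  · exact ⟨β', h3, hne⟩

theorem exists_length_ratio {α β : R.roots} (h : b.form (α : V) β ≠ 0) :
    ∃ m ∈ Finset.Icc (1 : ℤ) 4, ∃ n ∈ Finset.Icc (1 : ℤ) 4,
      b.form β β = b.form α α * ((m : ℝ) / n) := by
  have key : ∀ γ : R.roots, 0 < b.form (α : V) γ → ∃ m ∈ Finset.Icc (1 : ℤ) 4,
      ∃ n ∈ Finset.Icc (1 : ℤ) 4, b.form γ γ = b.form α α * ((m : ℝ) / n) := by
    intro γ h
    obtain ⟨m, n, hm, hn, -, -, hmn, h1, h2, -⟩ := b.exists_cartan h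
    refine ⟨m, Finset.mem_Icc.2 ⟨by omega, by nlinarith⟩, n, Finset.mem_Icc.2
      ⟨by omega, by nlinarith⟩, ?_⟩
    have : (n : ℝ) ≠ 0 := by exact_mod_cast hn.ne'
    field_simp
    linarith
  rcases lt_or_gt_of_ne h with h | h
  · have := key ⟨-β, neg_mem β.2⟩ (by simpa using h)
    simpa using this
  · exact key β h

/-- Squared lengths of nonorthogonal roots have ratio `m / n` with `m` and `n` between `1` and `4`,
and two such steps lead from a fixed root to any other. -/
theorem finite_lengths (hR : R.IsIrreducible) :
    (Set.range fun α : R.roots => b.form α α).Finite := by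
  obtain ⟨a, ha⟩ := hR.1
  let I := Finset.Icc (1 : ℤ) 4
  refine Set.Finite.subset (Finset.finite_toSet ((I ×ˢ I ×ˢ I ×ˢ I).image
    fun p => b.form a a * ((p.1 : ℝ) / p.2.1) * ((p.2.2.1 : ℝ) / p.2.2.2))) ?_
  rintro _ ⟨β, rfl⟩
  obtain ⟨γ, h1, h2⟩ := b.exists_nonorthogonal_both hR ⟨a, ha⟩ β
  obtain ⟨m, hm, n, hn, e⟩ := b.exists_length_ratio h1
  obtain ⟨m', hm', n', hn', e'⟩ := b.exists_length_ratio h2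
  simp only [Finset.coe_image, Set.mem_image, Finset.mem_coe, Finset.mem_product]
  refine ⟨(m, n, m', n'), ⟨hm, hn, hm', hn'⟩, ?_⟩
  simp only [e', e]

/-- Let `T` be a set of roots which is stable under the reflections in a set `B` of roots in the
kernel of `f`. If `β ∈ T` and `γ` have positive values under `f` and are proportional modulo the span
of `B`, then some element of `T` has positive inner product with `γ`. -/
theorem exists_form_pos {B : Set V} (hB : B ⊆ R.roots) {f : V →ₗ[ℝ] ℝ}
    (hf : ∀ x ∈ B, f x = 0) {T : Set V} (hT : T ⊆ R.roots)
    (hTB : ∀ δ : R.roots, (δ : V) ∈ B → ∀ x ∈ T, x - R.coroot δ x • (δ : V) ∈ T)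
    {β γ : V} (hβT : β ∈ T) (hβ : 0 < f β) (hγ : 0 < f γ)
    (hspan : f β • γ - f γ • β ∈ Submodule.span ℝ B) :
    ∃ o ∈ T, 0 < b.form o γ := by
  classical
  obtain ⟨S, hSB, hS⟩ := Submodule.mem_span_finite_of_mem_span hspan
  have hfin : (T ∩ {x | x - β ∈ Submodule.span ℝ (S : Set V)}).Finite := by
    refine (R.locallyFinite (Submodule.span ℝ ((insert β S : Finset V) : Set V))
      inferInstance).subset ?_
    rintro x ⟨hx, hx'⟩
    refine ⟨hT hx, ?_⟩
    rw [show x = (x - β) + β by abel]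
    refine Submodule.add_mem _ (Submodule.span_mono (by simp) hx') (Submodule.subset_span (by simp))
  set O := hfin.toFinset with hO
  have memO : ∀ x, x ∈ O ↔ x ∈ T ∧ x - β ∈ Submodule.span ℝ (S : Set V) := by
    intro x; simp [hO]
  have hβO : β ∈ O := (memO β).2 ⟨hβT, by simp⟩
  -- Averaging: `O` is stable under the reflections in `S`, so `σ` is orthogonal to `S`. Modulo the
  -- span of `S`, `γ` is a positive multiple of `β`, and `σ` pairs positively with `β` because `card
  -- O * (σ, β) = (σ, σ) > 0`.
  set σ := ∑ x ∈ O, x with hσ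
  have hSσ : ∀ u ∈ Submodule.span ℝ (S : Set V), b.form σ u = 0 := by
    intro u hu
    induction hu using Submodule.span_induction with
    | zero => simp
    | add x y _ _ hx hy => rw [map_add, hx, hy, add_zero]
    | smul r x _ hx => rw [map_smul, hx, smul_zero]
    | mem δ hδ =>
      have hδR := hB (hSB hδ)
      have hmem : ∀ x ∈ O, x - R.coroot ⟨δ, hδR⟩ x • δ ∈ O := by
        intro x hx
        rw [memO] at hx ⊢
        refine ⟨hTB ⟨δ, hδR⟩ (hSB hδ) x hx.1, ?_⟩
        rw [sub_right_comm]
        exact Submodule.sub_mem _ hx.2 (Submodule.smul_mem _ _ (Submodule.subset_span hδ))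
      have e : ∑ x ∈ O, (x - R.coroot ⟨δ, hδR⟩ x • δ) = ∑ x ∈ O, x :=
        Finset.sum_nbij' (fun x => x - R.coroot ⟨δ, hδR⟩ x • δ)
          (fun x => x - R.coroot ⟨δ, hδR⟩ x • δ) hmem hmem
          (fun x _ => R.reflection_reflection ⟨δ, hδR⟩ x)
          (fun x _ => R.reflection_reflection ⟨δ, hδR⟩ x) (fun x _ => rfl)
      rw [Finset.sum_sub_distrib, sub_eq_self, ← Finset.sum_smul, ← map_sum, smul_eq_zero] at e
      have e := e.resolve_right (ne_zero ⟨δ, hδR⟩)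
      rw [b.symm]
      exact (b.form_eq_zero_iff_coroot ⟨δ, hδR⟩ σ).1 e
  have hfS : ∀ u ∈ Submodule.span ℝ (S : Set V), f u = 0 := by
    intro u hu
    have : Submodule.span ℝ (S : Set V) ≤ LinearMap.ker f :=
      Submodule.span_le.2 fun x hx => hf x (hSB hx)
    exact this hu
  have hcard : 0 < (O.card : ℝ) := by exact_mod_cast Finset.card_pos.2 ⟨β, hβO⟩
  have hfσ : f σ = O.card * f β := by
    rw [hσ, map_sum, ← nsmul_eq_mul, ← Finset.sum_const]
    refine Finset.sum_congr rfl fun x hx => ?_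
    have := hfS _ ((memO x).1 hx).2
    rw [map_sub] at this; linarith
  have hσσ : b.form σ σ = O.card * b.form σ β := by
    conv_lhs => rw [hσ]
    rw [← hσ, b.symm, ← nsmul_eq_mul, ← Finset.sum_const]
    rw [show b.form σ σ = b.form σ (∑ x ∈ O, x) from rfl, map_sum]
    refine Finset.sum_congr rfl fun x hx => ?_
    have := hSσ _ ((memO x).1 hx).2
    rw [map_sub] at this; linarith
  have hσ0 : σ ≠ 0 := by
    intro h
    rw [h, map_zero] at hfσ
    exact (mul_pos hcard hβ).ne hfσ
  have h1 : 0 < b.form σ β := by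
    have := b.pos σ hσ0
    rw [hσσ] at this
    exact pos_of_mul_pos_right this hcard.le
  have h2 : 0 < b.form σ γ := by
    have e := hSσ _ hS
    rw [map_sub, map_smul, map_smul, smul_eq_mul, smul_eq_mul, sub_eq_zero] at e
    have : 0 < f β * b.form σ γ := by rw [e]; positivity
    exact pos_of_mul_pos_right this hβ.le
  rw [hσ, map_sum, LinearMap.sum_apply] at h2
  obtain ⟨o, ho, hpos⟩ := Finset.exists_lt_of_sum_lt (s := O) (f := fun _ => (0 : ℝ)) (by simpa using h2)
  exact ⟨o, ((memO o).1 ho).1, hpos⟩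

end InvariantForm

/-! ### Reflectable bases and their extension. -/

/-- A linearly independent set `B` of reduced roots which spans `U`, such that all reduced roots
in `U` are obtained from `B` by reflections. -/
structure IsReflectableBase (R : LocallyFiniteRootSystem V) (B : Set V) (U : Submodule ℝ V) :
    Prop where
  subset_redRoots : B ⊆ R.redRoots
  linearIndepOn : LinearIndepOn ℝ id B
  span_eq : Submodule.span ℝ B = U
  mem_of_isReflClosed : ∀ T : Set V, R.IsReflClosed T → B ⊆ T → ∀ γ ∈ R.redRoots, γ ∈ U → γ ∈ T

theorem isReflectableBase_empty : R.IsReflectableBase ∅ ⊥ where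
  subset_redRoots := Set.empty_subset _
  linearIndepOn := linearIndepOn_empty _ _
  span_eq := Submodule.span_empty
  mem_of_isReflClosed := fun _ _ _ γ hγ h =>
    absurd ((Submodule.mem_bot ℝ).1 h) (ne_zero ⟨γ, hγ.1⟩)

namespace InvariantForm

variable (b : R.InvariantForm)

/-- Among the roots with a given property there is one of maximal length. -/
theorem exists_longest (hR : R.IsIrreducible) {P : V → Prop} (h : ∃ v ∈ R.roots, P v) :
    ∃ v ∈ R.roots, P v ∧ ∀ w ∈ R.roots, P w → b.form w w ≤ b.form v v := by
  have hfin : ((fun v => b.form v v) '' {v | v ∈ R.roots ∧ P v}).Finite := by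
    refine (b.finite_lengths hR).subset ?_
    rintro _ ⟨v, hv, rfl⟩
    exact ⟨⟨v, hv.1⟩, rfl⟩
  obtain ⟨v, hv, hP⟩ := h
  obtain ⟨_, ⟨w, hw, rfl⟩, hmax⟩ := Set.exists_max_image _ id hfin ⟨_, ⟨v, ⟨hv, hP⟩, rfl⟩⟩
  exact ⟨w, hw.1, hw.2, fun u hu hPu => hmax _ ⟨u, ⟨hu, hPu⟩, rfl⟩⟩

end InvariantForm

/-- The root added is a longest one at the lowest positive level of `f`. By averaging, every root
`γ` of positive level has positive inner product with some `o` in `T` of the same level and length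
as the added root. Subtracting `o` shows that levels are multiples of the lowest one; reflecting in
`o` moves a reduced root `γ ≠ o` strictly closer to level zero, where `hB` applies. -/
theorem IsReflectableBase.exists_extend (b : R.InvariantForm) (hR : R.IsIrreducible) {B : Set V}
    {U U' : Submodule ℝ V} (hB : R.IsReflectableBase B U) (hUU' : U ≤ U') {f : V →ₗ[ℝ] ℝ}
    (hfU : ∀ x ∈ U, f x = 0) (hker : ∀ x ∈ U', f x = 0 → x ∈ U)
    (hmin : ∃ β ∈ R.roots, β ∈ U' ∧ 0 < f β ∧ ∀ γ ∈ R.roots, γ ∈ U' → 0 < f γ → f β ≤ f γ) :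
    ∃ B', R.IsReflectableBase B' U' := by
  obtain ⟨β₀, hβ₀, hβ₀U, hβ₀f, hmin⟩ := hmin
  obtain ⟨β, hβ, ⟨hβU, hβf⟩, hlong⟩ := b.exists_longest hR (P := fun v => v ∈ U' ∧ f v = f β₀)
    ⟨β₀, hβ₀, hβ₀U, rfl⟩
  rw [← hβf] at hβ₀f hmin
  replace hlong : ∀ w ∈ R.roots, w ∈ U' → f w = f β → b.form w w ≤ b.form β β :=
    fun w h1 h2 h3 => hlong w h1 ⟨h2, h3.trans hβf⟩
  clear hβ₀ hβ₀U hβf β₀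
  have hBroots : B ⊆ R.roots := fun x hx => (hB.subset_redRoots hx).1
  have hBU : ∀ x ∈ B, x ∈ U := fun x hx => hB.span_eq ▸ Submodule.subset_span hx
  have hBf : ∀ x ∈ B, f x = 0 := fun x hx => hfU x (hBU x hx)
  have hβred : β ∈ R.redRoots := by
    refine ⟨hβ, fun h => ?_⟩
    have := hmin _ h (Submodule.smul_mem _ _ hβU) (by rw [map_smul, smul_eq_mul]; positivity)
    rw [map_smul, smul_eq_mul] at this
    linarith
  have hUspan : ∀ x ∈ U', x - (f x / f β) • β ∈ Submodule.span ℝ B := by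
    intro x hx
    rw [hB.span_eq]
    refine hker _ (Submodule.sub_mem _ hx (Submodule.smul_mem _ _ hβU)) ?_
    rw [map_sub, map_smul, smul_eq_mul, div_mul_cancel₀ _ hβ₀f.ne', sub_self]
  have hpair : ∀ T : Set V, R.IsReflClosed T → insert β B ⊆ T → ∀ γ ∈ R.roots, γ ∈ U' → 0 < f γ →
      ∃ o ∈ R.roots, o ∈ T ∧ o ∈ U' ∧ f o = f β ∧ b.form o o = b.form β β ∧ 0 < b.form o γ := by
    intro T hT hBT γ hγ hγU hγf
    have hspan : f β • γ - f γ • β ∈ Submodule.span ℝ B := by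
      have := Submodule.smul_mem _ (f β) (hUspan γ hγU)
      rwa [smul_sub, smul_smul, mul_div_cancel₀ _ hβ₀f.ne'] at this
    have hstab : ∀ δ : R.roots, (δ : V) ∈ B →
        ∀ x ∈ {x | x ∈ R.roots ∧ x ∈ T ∧ x ∈ U' ∧ f x = f β ∧ b.form x x = b.form β β},
        x - R.coroot δ x • (δ : V) ∈
          {x | x ∈ R.roots ∧ x ∈ T ∧ x ∈ U' ∧ f x = f β ∧ b.form x x = b.form β β} := by
      rintro δ hδ x ⟨h1, h2, h3, h4, h5⟩
      refine ⟨R.reflection_mem δ ⟨x, h1⟩, hT δ ⟨x, h1⟩ (hBT (by simp [hδ])) h2,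
        Submodule.sub_mem _ h3 (Submodule.smul_mem _ _ (hUU' (hBU _ hδ))), ?_, ?_⟩
      · rw [map_sub, map_smul, hBf _ hδ, smul_zero, sub_zero, h4]
      · rw [b.form_reflection, h5]
    obtain ⟨o, ⟨h1, h2, h3, h4, h5⟩, hpos⟩ := b.exists_form_pos hBroots hBf
      (fun x hx => hx.1) hstab ⟨hβ, hBT (by simp), hβU, rfl, rfl⟩ hβ₀f hγf hspan
    exact ⟨o, h1, h2, h3, h4, h5, hpos⟩
  have hlevel : ∀ n : ℕ, ∀ γ ∈ R.roots, γ ∈ U' → 0 < f γ → f γ < n * f β →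
      ∃ m : ℕ, f γ = m * f β := by
    intro n
    induction n with
    | zero => intro γ _ _ h1 h2; simp at h2; linarith
    | succ n ih =>
      intro γ hγ hγU hγf hlt
      rcases (hmin γ hγ hγU hγf).eq_or_lt with h | h
      · exact ⟨1, by simp [h]⟩
      obtain ⟨o, ho, -, hoU, hof, -, hpos⟩ := hpair R.roots
        (fun α β _ _ => R.reflection_mem α β)
        (Set.insert_subset hβ hBroots) γ hγ hγU hγf
      have hsub := b.sub_mem_roots hγ ho (by rwa [b.symm]) (by rintro rfl; linarith)
      have e : f (γ - o) = f γ - f β := by rw [map_sub, hof]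
      push_cast at hlt
      obtain ⟨m, hm⟩ := ih _ hsub (Submodule.sub_mem _ hγU hoU) (by linarith) (by linarith)
      exact ⟨m + 1, by push_cast; linarith⟩
  refine ⟨insert β B, ⟨Set.insert_subset hβred hB.subset_redRoots, ?_, ?_, ?_⟩⟩
  · refine hB.linearIndepOn.id_insert fun h => ?_
    rw [hB.span_eq] at h
    exact hβ₀f.ne' (hfU β h)
  · apply le_antisymm
    · exact Submodule.span_le.2 (Set.insert_subset hβU fun x hx => hUU' (hBU x hx))
    · intro x hx
      rw [Submodule.mem_span_insert]
      exact ⟨f x / f β, _, hUspan x hx, by abel⟩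
  · intro T hT hBT
    have hmain : ∀ m : ℕ, ∀ γ ∈ R.redRoots, γ ∈ U' → f γ = m * f β → γ ∈ T := by
      intro m
      induction m using Nat.strong_induction_on with
      | _ m ih =>
      intro γ hγ hγU hγf
      rcases Nat.eq_zero_or_pos m with h0 | hm
      · refine hB.mem_of_isReflClosed T hT (fun x hx => hBT (by simp [hx])) γ hγ (hker γ hγU ?_)
        rw [hγf, h0]; simp
      have hmR : (0 : ℝ) < m := by exact_mod_cast hm
      have hγpos : 0 < f γ := by rw [hγf]; positivity
      obtain ⟨o, ho, hoT, hoU, hof, hoo, hpos⟩ := hpair T hT hBT γ hγ.1 hγU hγpos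
      obtain ⟨k, n, hk, hn, hk', -, hkn, ek, en, h4⟩ :=
        b.exists_cartan (α := ⟨o, ho⟩) (β := ⟨γ, hγ.1⟩) hpos
      have po := b.form_pos ⟨o, ho⟩
      by_cases heq : γ = o
      · rwa [heq]
      -- The reflected root has level `m - k`, so this bound makes the induction descend. For `m ≥
      -- 2` only `k = 4` is critical, and there `γ` would be twice a root. For `m = 1` maximality of
      -- length gives `k ≤ n`, so `k ≥ 2` would leave `k = n = 2`, that is `γ = o`.
      have hk2 : k < 2 * m := by
        rcases Nat.lt_or_ge 1 m with h1 | h1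
        · have : k ≠ 4 := by
            intro hk4
            have : k * n = 4 := by nlinarith
            have := h4 this
            rw [hk4] at this
            apply hγ.2
            rw [show γ = _ from this, smul_smul]
            norm_num
            exact ho
          have : k ≤ 4 := by nlinarith
          omega
        · have hm1 : m = 1 := by omega
          subst hm1
          have hle : b.form γ γ ≤ b.form o o := by
            rw [hoo]; exact hlong γ hγ.1 hγU (by rw [hγf]; simp)
          have hkn' : k ≤ n := by
            have h5 : (k : ℝ) * b.form o o = n * b.form γ γ := ek.trans en.symm
            have hnR : (0 : ℝ) < n := by exact_mod_cast hn
            have : (k : ℝ) ≤ n := by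
              by_contra hlt
              push Not at hlt
              nlinarith
            exact_mod_cast this
          by_contra hge
          push Not at hge
          push_cast at hge
          have h22 : k = 2 ∧ n = 2 := by constructor <;> nlinarith
          have := h4 (by rw [h22.1, h22.2]; norm_num)
          rw [h22.1] at this
          apply heq
          simpa using this
      set γ' := γ - R.coroot ⟨o, ho⟩ γ • o with hγ'
      have hγ'red : γ' ∈ R.redRoots := R.reflection_mem_redRoots ⟨o, ho⟩ hγ
      have hγ'U : γ' ∈ U' := Submodule.sub_mem _ hγU (Submodule.smul_mem _ _ hoU)
      have hγ'f : f γ' = ((m : ℤ) - k : ℤ) * f β := by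
        simp only at hk'
        rw [hγ', map_sub, map_smul, hof, hγf, hk', smul_eq_mul]; push_cast; ring
      have hγ'T : γ' ∈ T := by
        rcases le_total 0 ((m : ℤ) - k) with h | h
        · obtain ⟨j, hj⟩ := Int.eq_ofNat_of_zero_le h
          refine ih j (by omega) γ' hγ'red hγ'U ?_
          rw [hγ'f, hj]; simp
        · obtain ⟨j, hj⟩ := Int.eq_ofNat_of_zero_le (neg_nonneg.2 h)
          have hneg : -γ' ∈ R.redRoots := by
            refine ⟨neg_mem hγ'red.1, fun h => hγ'red.2 ?_⟩
            have := neg_mem h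
            rwa [smul_neg, neg_neg] at this
          have hj' : -γ' ∈ T := by
            refine ih j (by omega) (-γ') hneg (Submodule.neg_mem _ hγ'U) ?_
            rw [map_neg, hγ'f, ← neg_mul, ← Int.cast_neg, hj]; simp
          have := hT.neg_mem hneg.1 hj'
          rwa [neg_neg] at this
      have := hT ⟨o, ho⟩ ⟨γ', hγ'red.1⟩ hoT hγ'T
      have e := R.reflection_reflection ⟨o, ho⟩ γ
      simp only at this e
      rw [← hγ', ] at e
      rwa [e] at this
    have hpos : ∀ γ ∈ R.redRoots, γ ∈ U' → 0 < f γ → γ ∈ T := by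
      intro γ hγ hγU hγf
      obtain ⟨n, hn⟩ := exists_nat_gt (f γ / f β)
      obtain ⟨m, hm⟩ := hlevel n γ hγ.1 hγU hγf (by rwa [div_lt_iff₀ hβ₀f] at hn)
      exact hmain m γ hγ hγU hm
    intro γ hγ hγU
    rcases lt_trichotomy (f γ) 0 with h | h | h
    · have hneg : -γ ∈ R.redRoots := by
        refine ⟨neg_mem hγ.1, fun h => hγ.2 ?_⟩
        have := neg_mem h
        rwa [smul_neg, neg_neg] at this
      have := hT.neg_mem hneg.1 (hpos (-γ) hneg (Submodule.neg_mem _ hγU) (by simpa using h))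
      rwa [neg_neg] at this
    · exact hmain 0 γ hγ hγU (by simp [h])
    · exact hpos γ hγ hγU h

/-- A maximal subspace with a reflectable base contains all roots: otherwise adjoin a missing root,
and finiteness supplies the least positive level. -/
theorem exists_isReflectableBase_of_finite (b : R.InvariantForm) (hR : R.IsIrreducible)
    (hfin : R.roots.Finite) : ∃ B, R.IsReflectableBase B ⊤ := by
  have : FiniteDimensional ℝ V :=
    ⟨⟨hfin.toFinset, by rw [hfin.coe_toFinset, R.span_roots]⟩⟩
  obtain ⟨U, ⟨B, hB⟩, hmax⟩ := WellFounded.has_min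
    (wellFounded_gt : WellFounded (fun U U' : Submodule ℝ V => U > U'))
    {U | ∃ B, R.IsReflectableBase B U} ⟨⊥, ∅, isReflectableBase_empty⟩
  by_cases hU : R.roots ⊆ U
  · have : U = ⊤ := by
      rw [← top_le_iff, ← R.span_roots]
      exact Submodule.span_le.2 hU
    exact ⟨B, this ▸ hB⟩
  exfalso
  obtain ⟨α, hα, hαU⟩ := Set.not_subset.1 hU
  obtain ⟨f, hf, hfU⟩ := U.exists_le_ker_of_notMem hαU
  have hlt : U < U ⊔ Submodule.span ℝ {α} := by
    refine lt_of_le_of_ne le_sup_left fun h => hαU ?_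
    rw [h]
    exact Submodule.mem_sup_right (Submodule.mem_span_singleton_self α)
  refine hmax (U ⊔ Submodule.span ℝ {α}) ?_ hlt
  have hαU' : α ∈ U ⊔ Submodule.span ℝ {α} :=
    Submodule.mem_sup_right (Submodule.mem_span_singleton_self α)
  refine hB.exists_extend b hR le_sup_left (f := f) (fun x hx => hfU hx) ?_ ?_
  · intro x hx h0
    obtain ⟨u, hu, v, hv, rfl⟩ := Submodule.mem_sup.1 hx
    obtain ⟨r, rfl⟩ := Submodule.mem_span_singleton.1 hv
    have hu0 : f u = 0 := hfU hu
    rw [map_add, hu0, zero_add, map_smul, smul_eq_mul, mul_eq_zero] at h0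
    rw [h0.resolve_right hf]
    simpa using hu
  · obtain ⟨β, ⟨h1, h2, h3⟩, h4⟩ := Set.exists_min_image
      {v | v ∈ R.roots ∧ v ∈ U ⊔ Submodule.span ℝ {α} ∧ 0 < f v} f
      (hfin.subset fun v hv => hv.1) (by
        rcases lt_or_gt_of_ne hf with h | h
        · exact ⟨-α, neg_mem hα, Submodule.neg_mem _ hαU', by simpa using h⟩
        · exact ⟨α, hα, hαU', h⟩)
    exact ⟨β, h1, h2, h3, fun γ g1 g2 g3 => h4 γ ⟨g1, g2, g3⟩⟩

/-! ### Infinite simplices and the coordinates they define. -/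

namespace InvariantForm

variable (b : R.InvariantForm)

/-- A set of vectors whose differences are roots of norm `2`, as the set of standard basis vectors
in the usual description of the root system `A`. -/
def IsSimplex (J : Set V) : Prop :=
  J.Pairwise fun i j => i - j ∈ R.roots ∧ b.form (i - j) (i - j) = 2

/-- The combination `∑ tᵢ (i - m)` where `m` is the barycentre of `S`. -/
noncomputable def simplexVec (F S : Finset V) (t : V → ℝ) : V :=
  (S.card : ℝ)⁻¹ • ∑ i ∈ F, ∑ s ∈ S, t i • (i - s)

variable {b}

theorem simplexVec_mem {J : Set V} {F S : Finset V} (hF : ↑F ⊆ J) (hS : ↑S ⊆ J) (t : V → ℝ) :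
    simplexVec F S t ∈ Submodule.span ℝ {v | ∃ i ∈ J, ∃ j ∈ J, i - j = v} :=
  Submodule.smul_mem _ _ (Submodule.sum_mem _ fun i hi => Submodule.sum_mem _ fun s hs =>
    Submodule.smul_mem _ _ (Submodule.subset_span ⟨i, hF hi, s, hS hs, rfl⟩))

theorem form_simplexVec {F S : Finset V} (hS : S.Nonempty) (t : V → ℝ) {x : V} {k : ℝ}
    (hk : ∀ s ∈ S, b.form x s = k) :
    b.form x (simplexVec F S t) = ∑ i ∈ F, t i * (b.form x i - k) := by
  have hN : (S.card : ℝ) ≠ 0 := by exact_mod_cast hS.card_pos.ne'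
  have : ∀ i, b.form x (∑ s ∈ S, t i • (i - s)) = S.card * (t i * (b.form x i - k)) := by
    intro i
    rw [map_sum, ← nsmul_eq_mul, ← Finset.sum_const]
    refine Finset.sum_congr rfl fun s hs => ?_
    rw [map_smul, map_sub, hk s hs, smul_eq_mul]
  rw [simplexVec, map_smul, map_sum]
  simp only [this, ← Finset.mul_sum, smul_eq_mul]
  rw [inv_mul_cancel_left₀ hN]

/-- Differences of vertices pair like differences of orthonormal vectors; the two exclusions
suppress the negative terms. -/
theorem IsSimplex.form_sub_sub [DecidableEq V] {J : Set V} (hJ : b.IsSimplex J) {i j s t : V}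
    (hi : i ∈ J) (hj : j ∈ J) (hs : s ∈ J) (ht : t ∈ J) (hit : i ≠ t) (hjs : j ≠ s) :
    b.form (i - s) (j - t) = (if i = j then 1 else 0) + if s = t then 1 else 0 := by
  have h1 := (hJ hi ht hit).2
  have h2 := (hJ hj hs hjs).2
  have e : ∀ x ∈ J, ∀ y ∈ J, b.form (x - y) (x - y) = 2 - if x = y then 2 else 0 := by
    intro x hx y hy
    split_ifs with h
    · simp [h]
    · rw [(hJ hx hy h).2, sub_zero]
  have h3 := e i hi j hj
  have h4 := e s hs t ht
  simp only [map_sub, LinearMap.sub_apply, b.symm j i, b.symm t i, b.symm s j,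
    b.symm t s] at h1 h2 h3 h4 ⊢
  split_ifs at * <;> linarith

/-- In the orthonormal model the barycentre of `S` has squared norm `1 / card S` and is orthogonal
to the vertices in `F`. -/
theorem IsSimplex.form_simplexVec_self {J : Set V} (hJ : b.IsSimplex J) {F S : Finset V}
    (hF : ↑F ⊆ J) (hS : ↑S ⊆ J) (hd : Disjoint F S) (hne : S.Nonempty) (t : V → ℝ) :
    b.form (simplexVec F S t) (simplexVec F S t) =
      ∑ i ∈ F, t i ^ 2 + (∑ i ∈ F, t i) ^ 2 / S.card := by
  classical
  have hN : (S.card : ℝ) ≠ 0 := by exact_mod_cast hne.card_pos.ne'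
  have hne' : ∀ i ∈ F, ∀ s ∈ S, i ≠ s := fun i hi s hs h => Finset.disjoint_left.1 hd hi (h ▸ hs)
  have key : ∀ i ∈ F, ∀ j ∈ F, ∑ s ∈ S, ∑ r ∈ S, b.form (i - s) (j - r) =
      (if i = j then (S.card : ℝ) ^ 2 else 0) + S.card := by
    intro i hi j hj
    have : ∀ s ∈ S, ∑ r ∈ S, b.form (i - s) (j - r) =
        S.card * (if i = j then (1 : ℝ) else 0) + 1 := by
      intro s hs
      have e : ∑ r ∈ S, b.form (i - s) (j - r) =
          ∑ r ∈ S, ((if i = j then (1 : ℝ) else 0) + if s = r then 1 else 0) :=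
        Finset.sum_congr rfl fun r hr => hJ.form_sub_sub (hF hi) (hF hj) (hS hs) (hS hr)
          (hne' i hi r hr) (hne' j hj s hs)
      rw [e, Finset.sum_add_distrib, Finset.sum_const, Finset.sum_ite_eq, if_pos hs, nsmul_eq_mul]
    rw [Finset.sum_congr rfl this, Finset.sum_const, nsmul_eq_mul]
    split_ifs <;> ring
  have hexp : b.form (simplexVec F S t) (simplexVec F S t) = ((S.card : ℝ)⁻¹ * (S.card : ℝ)⁻¹) *
      ∑ i ∈ F, ∑ j ∈ F, t i * t j * ∑ s ∈ S, ∑ r ∈ S, b.form (i - s) (j - r) := by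
    simp only [simplexVec, ← Finset.smul_sum, map_smul, map_sum, LinearMap.smul_apply,
      LinearMap.sum_apply, smul_eq_mul, Finset.mul_sum]
    refine Finset.sum_congr rfl fun i _ => ?_
    rw [Finset.sum_comm]
    refine Finset.sum_congr rfl fun j _ => ?_
    refine Finset.sum_congr rfl fun s _ => Finset.sum_congr rfl fun r _ => ?_
    rw [b.symm (j - r) (i - s)]
    ring
  rw [hexp, Finset.sum_congr rfl fun i hi => Finset.sum_congr rfl fun j hj => by rw [key i hi j hj]]
  have : ∀ i ∈ F, ∑ j ∈ F, t i * t j * ((if i = j then (S.card : ℝ) ^ 2 else 0) + S.card) =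
      (S.card : ℝ) ^ 2 * t i ^ 2 + S.card * (t i * ∑ j ∈ F, t j) := by
    intro i hi
    simp only [mul_add, Finset.sum_add_distrib, mul_ite, mul_zero, Finset.sum_ite_eq, if_pos hi,
      Finset.mul_sum]
    congr 1
    · ring
    · exact Finset.sum_congr rfl fun j _ => by ring
  rw [Finset.sum_congr rfl this, Finset.sum_add_distrib, ← Finset.mul_sum, ← Finset.mul_sum,
    ← Finset.sum_mul]
  field_simp

theorem IsSimplex.exists_int {J : Set V} (hJ : b.IsSimplex J) {α : V} (hα : α ∈ R.roots) {i j : V}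
    (hi : i ∈ J) (hj : j ∈ J) : ∃ n : ℤ, b.form α i - b.form α j = n := by
  by_cases hij : i = j
  · exact ⟨0, by simp [hij]⟩
  obtain ⟨h1, h2⟩ := hJ hi hj hij
  obtain ⟨n, hn⟩ := R.integral ⟨_, h1⟩ ⟨α, hα⟩
  refine ⟨n, ?_⟩
  have := b.coroot_mul ⟨_, h1⟩ α
  simp only at this hn
  rw [hn, h2, b.symm, map_sub] at this
  linarith

/-- Pairings of `α` with vertices differ by bounded integers, so some value `k` occurs infinitely
often. If `n` vertices had other values, the combination with suitable signs, balanced against `n`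
vertices of value `k`, would pair with `α` to at least `n` and have squared norm at most `2 n`.
Cauchy–Schwarz bounds `n`. -/
theorem IsSimplex.exists_limit_root {J : Set V} (hJ : b.IsSimplex J) (hinf : J.Infinite) {α : V}
    (hα : α ∈ R.roots) : ∃ k : ℝ, {i | i ∈ J ∧ b.form α i ≠ k}.Finite := by
  obtain ⟨i₀, hi₀⟩ := hinf.nonempty
  have hvals : ((fun i => b.form α i) '' J).Finite := by
    obtain ⟨M, hM⟩ := exists_nat_gt (2 * b.form α α)
    refine Set.Finite.subset (Finset.finite_toSet ((Finset.Icc (-M : ℤ) M).image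
      fun n : ℤ => b.form α i₀ + n)) ?_
    rintro _ ⟨i, hi, rfl⟩
    obtain ⟨n, hn⟩ := hJ.exists_int hα hi hi₀
    simp only [Finset.coe_image, Set.mem_image, Finset.mem_coe, Finset.mem_Icc]
    refine ⟨n, ?_, by rw [← hn]; ring⟩
    have hsq : (n : ℝ) ^ 2 ≤ 2 * b.form α α := by
      by_cases h : i = i₀
      · have : (n : ℝ) = 0 := by rw [← hn, h]; ring
        rw [this]
        have := b.nonneg α
        norm_num; exact this
      · have := b.sq_le α (i - i₀)
        rw [map_sub, hn, (hJ hi hi₀ h).2] at this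
        linarith
    have : n ^ 2 < (M : ℤ) := by exact_mod_cast hsq.trans_lt hM
    constructor <;> nlinarith
  have hk : ∃ k, {i | i ∈ J ∧ b.form α i = k}.Infinite := by
    by_contra hcon
    push Not at hcon
    refine hinf (Set.Finite.of_finite_fibers (fun i => b.form α i) hvals fun k _ => ?_)
    exact (hcon k).subset fun i hi => ⟨hi.1, hi.2⟩
  obtain ⟨k, hk⟩ := hk
  refine ⟨k, ?_⟩
  by_contra hinf'
  obtain ⟨n, hn⟩ := exists_nat_gt (2 * b.form α α)
  have hpos : 0 < 2 * b.form α α := by have := b.form_pos ⟨α, hα⟩; simp only at this; linarith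
  have hn0 : 0 < (n : ℝ) := hpos.trans hn
  obtain ⟨F, hF, hFn⟩ := Set.Infinite.exists_subset_card_eq hinf' n
  obtain ⟨S, hS, hSn⟩ := hk.exists_subset_card_eq n
  have hSne : S.Nonempty := Finset.card_pos.1 (by rw [hSn]; exact_mod_cast hn0)
  have hd : Disjoint F S := Finset.disjoint_left.2 fun i h1 h2 => (hF h1).2 (hS h2).2
  obtain ⟨s, hs⟩ := hSne
  let t : V → ℝ := fun i => SignType.sign (b.form α i - k)
  have e1 := b.form_simplexVec (F := F) ⟨s, hs⟩ t (x := α) (k := k) fun s hs => (hS hs).2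
  have e2 := hJ.form_simplexVec_self (fun i hi => (hF hi).1) (fun i hi => (hS hi).1) hd ⟨s, hs⟩ t
  have l1 : (n : ℝ) ≤ b.form α (simplexVec F S t) := by
    rw [e1, ← hFn, ← nsmul_one, ← Finset.sum_const]
    refine Finset.sum_le_sum fun i hi => ?_
    simp only [t, sign_mul_self]
    obtain ⟨m, hm⟩ := hJ.exists_int hα (hF hi).1 (hS hs).1
    rw [(hS hs).2] at hm
    have hm0 : m ≠ 0 := by
      rintro rfl
      apply (hF hi).2
      push_cast at hm
      linarith
    rw [hm]
    exact_mod_cast Int.one_le_abs hm0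
  have ht : ∀ i, |t i| ≤ 1 := by
    intro i
    rcases lt_trichotomy (b.form α i - k) 0 with h | h | h <;> simp [t, h]
  have l2 : b.form (simplexVec F S t) (simplexVec F S t) ≤ 2 * n := by
    have h1 : ∑ i ∈ F, t i ^ 2 ≤ n := by
      rw [← hFn, ← nsmul_one, ← Finset.sum_const]
      exact Finset.sum_le_sum fun i _ => (sq_le_one_iff_abs_le_one _).2 (ht i)
    have h2 : |∑ i ∈ F, t i| ≤ n := by
      refine (Finset.abs_sum_le_sum_abs _ _).trans ?_
      rw [← hFn, ← nsmul_one, ← Finset.sum_const]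
      exact Finset.sum_le_sum fun i _ => ht i
    have h3 : (∑ i ∈ F, t i) ^ 2 / S.card ≤ n := by
      rw [hSn, div_le_iff₀ hn0, ← sq, ← sq_abs]
      gcongr
    rw [e2]; linarith
  have hcs := b.sq_le α (simplexVec F S t)
  have h1 : (n : ℝ) ^ 2 ≤ b.form α (simplexVec F S t) ^ 2 := by gcongr
  have h2 := mul_le_mul_of_nonneg_left l2 (b.nonneg α)
  nlinarith

theorem IsSimplex.exists_limit {J : Set V} (hJ : b.IsSimplex J) (hinf : J.Infinite) (x : V) :
    ∃ k : ℝ, {i | i ∈ J ∧ b.form x i ≠ k}.Finite := by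
  have hx : x ∈ Submodule.span ℝ R.roots := R.span_roots ▸ Submodule.mem_top
  induction hx using Submodule.span_induction with
  | mem v hv => exact hJ.exists_limit_root hinf hv
  | zero => exact ⟨0, by simp⟩
  | add x y _ _ hx hy =>
    obtain ⟨k, hk⟩ := hx
    obtain ⟨l, hl⟩ := hy
    refine ⟨k + l, (hk.union hl).subset fun i hi => ?_⟩
    by_contra hcon
    simp only [Set.mem_union, Set.mem_ofPred_eq, not_or, not_and, not_not] at hcon
    exact hi.2 (by rw [map_add, LinearMap.add_apply, hcon.1 hi.1, hcon.2 hi.1])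
  | smul r x _ hx =>
    obtain ⟨k, hk⟩ := hx
    refine ⟨r * k, hk.subset fun i hi => ⟨hi.1, fun h => hi.2 ?_⟩⟩
    rw [map_smul, LinearMap.smul_apply, h, smul_eq_mul]

/-- The coordinates with respect to an infinite simplex. -/
theorem IsSimplex.exists_coord {J : Set V} (hJ : b.IsSimplex J) (hinf : J.Infinite) :
    ∃ (ι : V →ₗ[ℝ] (J →₀ ℝ)) (κ : V →ₗ[ℝ] ℝ), ∀ x (i : J), ι x i = b.form x i - κ x := by
  choose k hk using hJ.exists_limit hinf
  have huniq : ∀ x l, {i | i ∈ J ∧ b.form x i ≠ l}.Finite → k x = l := by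
    intro x l hl
    obtain ⟨i, hi, hni⟩ := hinf.exists_notMem_finite ((hk x).union hl)
    simp only [Set.mem_union, Set.mem_ofPred_eq, not_or, not_and, not_not] at hni
    rw [← hni.1 hi, hni.2 hi]
  let κ : V →ₗ[ℝ] ℝ :=
    { toFun := k
      map_add' := fun x y => huniq _ _ (((hk x).union (hk y)).subset fun i hi => by
        by_contra hcon
        simp only [Set.mem_union, Set.mem_ofPred_eq, not_or, not_and, not_not] at hcon
        exact hi.2 (by rw [map_add, LinearMap.add_apply, hcon.1 hi.1, hcon.2 hi.1]))
      map_smul' := fun r x => huniq _ _ ((hk x).subset fun i hi => ⟨hi.1, fun h => hi.2 (by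
        rw [map_smul, LinearMap.smul_apply, h, smul_eq_mul, RingHom.id_apply, smul_eq_mul])⟩) }
  have hfin : ∀ x, (Function.support fun i : J => b.form x i - k x).Finite := by
    intro x
    refine Set.Finite.of_finite_image (f := Subtype.val) ((hk x).subset ?_)
      Subtype.val_injective.injOn
    rintro _ ⟨i, hi, rfl⟩
    exact ⟨i.2, fun h => hi (by simp [h])⟩
  refine ⟨{ toFun := fun x => Finsupp.ofSupportFinite _ (hfin x)
            map_add' := fun x y => ?_
            map_smul' := fun r x => ?_ }, κ, fun x i => rfl⟩
  · ext i
    change b.form (x + y) i - κ (x + y) = (b.form x i - κ x) + (b.form y i - κ y)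
    rw [map_add, map_add, LinearMap.add_apply]; ring
  · ext i
    change b.form (r • x) i - κ (r • x) = r * (b.form x i - κ x)
    rw [map_smul, map_smul, LinearMap.smul_apply, smul_eq_mul, smul_eq_mul]; ring

/-- A maximal infinite simplex, with the coordinates that it defines. -/
structure StdCoord (b : R.InvariantForm) where
  /-- The vertices of the simplex. -/
  J : Set V
  simplex : b.IsSimplex J
  infinite : J.Infinite
  maximal : ∀ v, (∀ j ∈ J, v ≠ j → v - j ∈ R.roots ∧ b.form (v - j) (v - j) = 2) → v ∈ J
  /-- The coordinates. -/
  coord : V →ₗ[ℝ] (J →₀ ℝ)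
  /-- The common value of almost all `b.form x i`, for `i ∈ J`. -/
  limit : V →ₗ[ℝ] ℝ
  coord_apply : ∀ x (i : J), coord x i = b.form x i - limit x

theorem exists_stdCoord {J : Set V} (hJ : b.IsSimplex J) (hinf : J.Infinite) :
    Nonempty b.StdCoord := by
  obtain ⟨M, hJM, hM⟩ := zorn_subset_nonempty {M | b.IsSimplex M} (fun c hc hchain _ =>
    ⟨⋃₀ c, (Set.pairwise_sUnion hchain.directedOn).2 hc, fun s hs => Set.subset_sUnion_of_mem hs⟩)
    J hJ
  have hMs : b.IsSimplex M := hM.prop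
  obtain ⟨ι, κ, h⟩ := hMs.exists_coord (hinf.mono hJM)
  refine ⟨⟨M, hMs, hinf.mono hJM, fun v hv => ?_, ι, κ, h⟩⟩
  have hins : b.IsSimplex (insert v M) := by
    refine hMs.insert fun j hj hne => ⟨hv j hj hne, ?_⟩
    have := hv j hj hne
    rw [← neg_sub v j]
    refine ⟨neg_mem this.1, ?_⟩
    rw [map_neg, map_neg, LinearMap.neg_apply, neg_neg, this.2]
  exact hM.le_of_ge hins (Set.subset_insert v M) (Set.mem_insert v M)

/-! ### The roots in the coordinates of a maximal simplex. -/

namespace StdCoord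

variable (E : b.StdCoord)

/-- The linear span of the differences of the vertices. -/
def diffSpan : Submodule ℝ V := Submodule.span ℝ {v | ∃ i ∈ E.J, ∃ j ∈ E.J, i - j = v}

/-- The norm of the vector of coordinates. -/
noncomputable def normSq (x : V) : ℝ := ∑ i ∈ (E.coord x).support, E.coord x i ^ 2

theorem coord_sub (x : V) (i j : E.J) :
    b.form x ((i : V) - j) = E.coord x i - E.coord x j := by
  rw [map_sub, E.coord_apply, E.coord_apply]; ring

theorem exists_notMem (s : Finset E.J) : ∃ i : E.J, i ∉ s := by
  have : Infinite E.J := E.infinite.to_subtype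
  exact Infinite.exists_notMem_finset s

/-- The vector `u` has the coordinates of `x` as coefficients, balanced against `N` vertices where
the coordinates of `x` and `y` vanish. It replaces an orthogonal projection of `x`, approached only
as `N → ∞`. -/
theorem exists_approx (x y : V) {N : ℕ} (hN : 0 < N) : ∃ u ∈ E.diffSpan,
    b.form x u = E.normSq x ∧
    b.form y u = ∑ i ∈ (E.coord x).support, E.coord x i * E.coord y i ∧
    b.form u u = E.normSq x + (∑ i ∈ (E.coord x).support, E.coord x i) ^ 2 / N := by
  classical
  have : Infinite E.J := E.infinite.to_subtype
  obtain ⟨S, hS, hSN⟩ := ((E.coord x).support ∪ (E.coord y).support).finite_toSet.infinite_compl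
    |>.exists_subset_card_eq N
  have hS' : ∀ i ∈ S, E.coord x i = 0 ∧ E.coord y i = 0 := by
    intro i hi
    simpa [not_or] using hS hi
  let e : E.J ↪ V := Function.Embedding.subtype _
  have hSne : (S.map e).Nonempty := by
    rw [Finset.map_nonempty, ← Finset.card_pos, hSN]; exact hN
  let t : V → ℝ := fun v => b.form x v - E.limit x
  have ht : ∀ i : E.J, t i = E.coord x i := fun i => (E.coord_apply x i).symm
  have hsub : ∀ T : Finset E.J, ((T.map e : Finset V) : Set V) ⊆ E.J := by
    intro T v hv
    obtain ⟨i, -, rfl⟩ := Finset.mem_map.1 hv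
    exact i.2
  have hd : Disjoint ((E.coord x).support.map e) (S.map e) := by
    rw [Finset.disjoint_map]
    exact Finset.disjoint_left.2 fun i h1 h2 => Finsupp.mem_support_iff.1 h1 (hS' i h2).1
  have hx := b.form_simplexVec (F := (E.coord x).support.map e) hSne t (x := x) (k := E.limit x)
    (by
      intro s hs
      obtain ⟨i, hi, rfl⟩ := Finset.mem_map.1 hs
      have := E.coord_apply x i
      rw [(hS' i hi).1] at this
      exact (sub_eq_zero.1 this.symm))
  have hy := b.form_simplexVec (F := (E.coord x).support.map e) hSne t (x := y) (k := E.limit y)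
    (by
      intro s hs
      obtain ⟨i, hi, rfl⟩ := Finset.mem_map.1 hs
      have := E.coord_apply y i
      rw [(hS' i hi).2] at this
      exact (sub_eq_zero.1 this.symm))
  have hu := E.simplex.form_simplexVec_self (hsub (E.coord x).support) (hsub S) hd hSne t
  refine ⟨_, simplexVec_mem (hsub (E.coord x).support) (hsub S) t, ?_, ?_, ?_⟩
  · rw [hx, Finset.sum_map]
    refine Finset.sum_congr rfl fun i _ => ?_
    change t i * (b.form x i - E.limit x) = _
    rw [ht, ← E.coord_apply, sq]
  · rw [hy, Finset.sum_map]
    refine Finset.sum_congr rfl fun i _ => ?_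
    change t i * (b.form y i - E.limit y) = _
    rw [ht, ← E.coord_apply]
  · rw [hu, Finset.sum_map, Finset.sum_map, Finset.card_map, hSN]
    simp only [show ∀ i : E.J, t (e i) = E.coord x i from ht]
    rfl

theorem le_of_forall_le_add_div {a c d : ℝ} (h : ∀ N : ℕ, 0 < N → a ≤ c + d / N) : a ≤ c := by
  have : Filter.Tendsto (fun N : ℕ => c + d / N) Filter.atTop (nhds (c + 0)) :=
    (tendsto_const_div_atTop_nhds_zero_nat d).const_add c
  rw [add_zero] at this
  refine ge_of_tendsto this ?_
  filter_upwards [Filter.eventually_gt_atTop 0] with N hN using h N hN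

/-- This is Bessel's inequality: expand `0 ≤ (x - u, x - u)` and let `N → ∞`. -/
theorem normSq_le (x : V) : E.normSq x ≤ b.form x x := by
  refine le_of_forall_le_add_div
    (d := (∑ i ∈ (E.coord x).support, E.coord x i) ^ 2) fun N hN => ?_
  obtain ⟨u, -, h1, -, h2⟩ := E.exists_approx x x hN
  have := b.nonneg (x - u)
  simp only [map_sub, LinearMap.sub_apply, b.symm u x, h1, h2] at this
  linarith

/-- Equality in Bessel's inequality makes `x` a limit of the vectors `u` of `exists_approx`, all of
which are orthogonal to `y`. -/
theorem form_eq_zero {x y : V} (hx : E.normSq x = b.form x x) (hy : E.coord y = 0) :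
    b.form x y = 0 := by
  have : b.form x y ^ 2 ≤ 0 := by
    refine le_of_forall_le_add_div
      (d := (∑ i ∈ (E.coord x).support, E.coord x i) ^ 2 * b.form y y) fun N hN => ?_
    obtain ⟨u, -, h1, h2, h3⟩ := E.exists_approx x y hN
    simp only [hy, Finsupp.zero_apply, mul_zero, Finset.sum_const_zero] at h2
    have := b.sq_le (x - u) y
    simp only [map_sub, LinearMap.sub_apply, b.symm u x, b.symm u y, h1, h2, h3, sub_zero, hx]
      at this
    refine this.trans (le_of_eq ?_)
    ring
  exact pow_eq_zero_iff two_ne_zero |>.1 (le_antisymm this (sq_nonneg _))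

theorem coord_diff (i j : E.J) :
    E.coord ((i : V) - j) = Finsupp.single i 1 - Finsupp.single j 1 := by
  classical
  by_cases hij : i = j
  · simp [hij]
  have hv : (i : V) ≠ j := fun h => hij (Subtype.ext h)
  obtain ⟨l, hl⟩ := E.exists_notMem (insert i (insert j (E.coord ((i : V) - j)).support))
  simp only [Finset.mem_insert, Finsupp.mem_support_iff, not_or, not_not] at hl
  have hli : (i : V) ≠ l := fun h => hl.1 (Subtype.ext h.symm)
  have hlj : (j : V) ≠ l := fun h => hl.2.1 (Subtype.ext h.symm)
  ext k
  have e := E.coord_sub ((i : V) - j) k l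
  rw [hl.2.2, sub_zero] at e
  rw [← e, b.symm, Finsupp.sub_apply, Finsupp.single_apply, Finsupp.single_apply]
  by_cases hkj : k = j
  · subst hkj
    rw [if_neg hij, if_pos rfl]
    have := E.simplex.form_sub_sub l.2 i.2 k.2 k.2 hlj.symm hv
    rw [if_neg (fun h => hli h.symm), if_pos rfl] at this
    rw [← neg_sub (l : V) k, map_neg, LinearMap.neg_apply, this]; norm_num
  · have hkj' : (k : V) ≠ j := fun h => hkj (Subtype.ext h)
    have := E.simplex.form_sub_sub k.2 i.2 l.2 j.2 hkj' hli
    have h1 : ¬ (l : V) = j := fun h => hlj h.symm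
    have h2 : ¬ j = k := fun h => hkj h.symm
    rw [this, if_neg h1, if_neg h2, add_zero, sub_zero]
    simp [Subtype.ext_iff, eq_comm]

theorem normSq_diff (c : ℝ) {i j : E.J} (hij : i ≠ j) :
    E.normSq (c • ((i : V) - j)) = b.form (c • ((i : V) - j)) (c • ((i : V) - j)) := by
  classical
  have hv : (i : V) ≠ j := fun h => hij (Subtype.ext h)
  have h2 := (E.simplex i.2 j.2 hv).2
  have : E.normSq (c • ((i : V) - j)) =
      ∑ k ∈ {i, j}, E.coord (c • ((i : V) - j)) k ^ 2 := by
    refine Finset.sum_subset ?_ fun k _ hk => ?_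
    · intro k hk
      by_contra hcon
      simp only [Finset.mem_insert, Finset.mem_singleton, not_or] at hcon
      rw [Finsupp.mem_support_iff, map_smul, coord_diff] at hk
      simp [Ne.symm hcon.1, Ne.symm hcon.2] at hk
    · rw [Finsupp.notMem_support_iff.1 hk]; norm_num
  rw [this, Finset.sum_pair hij, map_smul, coord_diff]
  simp only [map_smul, LinearMap.smul_apply, h2, Finsupp.smul_apply, Finsupp.sub_apply,
    Finsupp.single_eq_same, Finsupp.single_eq_of_ne hij, Finsupp.single_eq_of_ne hij.symm,
    smul_eq_mul]
  ring

theorem coord_int {α : V} (hα : α ∈ R.roots) (i : E.J) : ∃ n : ℤ, E.coord α i = n := by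
  obtain ⟨l, hl⟩ := E.exists_notMem (E.coord α).support
  obtain ⟨n, hn⟩ := E.simplex.exists_int hα i.2 l.2
  refine ⟨n, ?_⟩
  rw [← hn, ← map_sub, E.coord_sub, Finsupp.notMem_support_iff.1 hl, sub_zero]

/-- The possible coordinates of a root. -/
theorem root_coord {α : V} (hα : α ∈ R.roots) {i : E.J} (hi : E.coord α i ≠ 0) :
    (∃ j : E.J, j ≠ i ∧ ∃ c : ℝ, α = c • ((i : V) - j)) ∨
    ∃ m n : ℤ, 0 < m ∧ 0 < n ∧ |E.coord α i| = m ∧ n * b.form α α = 2 * m ∧ m * n < 4 := by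
  classical
  -- Pairing with the root `i - j`, for a vertex `j` where the coordinate vanishes, isolates the
  -- coordinate at `i` and makes it a Cartan integer.
  obtain ⟨j, hj⟩ := E.exists_notMem (insert i (E.coord α).support)
  simp only [Finset.mem_insert, Finsupp.mem_support_iff, not_or, not_not] at hj
  have hv : (i : V) ≠ j := fun h => hj.1 (Subtype.ext h.symm)
  obtain ⟨hr, h2⟩ := E.simplex i.2 j.2 hv
  have e := E.coord_sub α i j
  rw [hj.2, sub_zero, b.symm] at e
  have key : ∀ γ : R.roots, b.form γ γ = 2 → b.form γ α = |E.coord α i| →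
      (∃ c : ℝ, α = c • (γ : V)) ∨
      ∃ m n : ℤ, 0 < m ∧ 0 < n ∧ |E.coord α i| = m ∧ n * b.form α α = 2 * m ∧ m * n < 4 := by
    intro γ hγ h
    obtain ⟨m, n, hm, hn, -, -, hmn, em, en, h4⟩ :=
      b.exists_cartan (α := γ) (β := ⟨α, hα⟩) (by simp only [h]; positivity)
    rcases hmn.lt_or_eq with hlt | heq
    · refine Or.inr ⟨m, n, hm, hn, ?_, ?_, hlt⟩
      · rw [← h]; rw [hγ] at em; simp only at em; linarith
      · simp only at en em; rw [en, ← em, hγ]; ring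
    · exact Or.inl ⟨_, h4 heq⟩
  rcases lt_or_gt_of_ne hi with h | h
  · rcases key ⟨-(i - j), neg_mem hr⟩ 
      (by simpa only [map_neg, LinearMap.neg_apply, neg_neg] using h2)
      (by simp only [map_neg, LinearMap.neg_apply, e, abs_of_neg h])
      with ⟨c, hc⟩ | h
    · exact Or.inl ⟨j, hj.1, -c, by rw [hc]; module⟩
    · exact Or.inr h
  · rcases key ⟨i - j, hr⟩ h2 (by simp only [e, abs_of_pos h]) with ⟨c, hc⟩ | h
    · exact Or.inl ⟨j, hj.1, c, hc⟩
    · exact Or.inr h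

/-- Otherwise `i - α` differs from every vertex other than itself by a root of norm `2`, hence is a
vertex by maximality. Then `α` is a difference of two vertices and has a coordinate `-1`. -/
theorem coord_ne_single_one {α : V} (hα : α ∈ R.roots) (h2 : b.form α α = 2) (i : E.J) :
    E.coord α ≠ Finsupp.single i 1 := by
  classical
  intro h
  have hmem : (i : V) - α ∈ E.J := by
    refine E.maximal _ fun j hj hne => ?_
    by_cases hij : (i : V) = j
    · rw [← hij, sub_sub_cancel_left]
      exact ⟨neg_mem hα, by simpa using h2⟩
    obtain ⟨r1, r2⟩ := E.simplex i.2 hj hij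
    have hij' : (⟨j, hj⟩ : E.J) ≠ i := fun h => hij (by rw [← h])
    have e := E.coord_sub α i ⟨j, hj⟩
    rw [h, Finsupp.single_eq_same, Finsupp.single_eq_of_ne hij', sub_zero, b.symm] at e
    rw [sub_right_comm]
    refine ⟨b.sub_mem_roots r1 hα (by rw [e]; norm_num) fun h => hne (by rw [← h]; abel), ?_⟩
    rw [map_sub b.form, LinearMap.sub_apply, map_sub (b.form ((i : V) - j)),
      map_sub (b.form α), b.symm α, e, h2, r2]
    norm_num
  have hne : (⟨(i : V) - α, hmem⟩ : E.J) ≠ i := by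
    intro h
    have := congrArg Subtype.val h
    simp only [sub_eq_self] at this
    exact ne_zero ⟨α, hα⟩ this
  have e := E.coord_diff i ⟨(i : V) - α, hmem⟩
  rw [show (i : V) - ((⟨(i : V) - α, hmem⟩ : E.J) : V) = α by simp, h] at e
  have := DFunLike.congr_fun e ⟨(i : V) - α, hmem⟩
  rw [Finsupp.sub_apply, Finsupp.single_eq_same, Finsupp.single_eq_of_ne hne] at this
  norm_num at this

/-- By maximality of the simplex, a single coordinate `±1` does not occur for roots of norm `2`. -/
theorem coord_ne_single {α : V} (hα : α ∈ R.roots) (h2 : b.form α α = 2) (i : E.J) {a : ℝ}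
    (ha : |a| = 1) : E.coord α ≠ Finsupp.single i a := by
  intro h
  rcases (abs_eq zero_le_one).1 ha with rfl | rfl
  · exact E.coord_ne_single_one hα h2 i h
  · refine E.coord_ne_single_one (α := -α) (neg_mem hα) (by simpa using h2) i ?_
    rw [map_neg, h, ← Finsupp.single_neg, neg_neg]

/-- Unless `α` is proportional to a difference of vertices, a nonzero coordinate is `±m` with `n (α,
α) = 2 m`, and Bessel's inequality gives `m n ≤ 2`. So either this coordinate exhausts the norm, or
`(α, α) = 2` and it is `±1`. If only the latter occurs, at most two coordinates are nonzero, and a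
single one contradicts maximality. -/
theorem root_cases {α : V} (hα : α ∈ R.roots) (h0 : E.coord α ≠ 0) :
    E.normSq α = b.form α α ∧
    ((∃ i j : E.J, i ≠ j ∧ ∃ c : ℝ, α = c • ((i : V) - j)) ∨
     (∃ (i : E.J) (a : ℝ), a ≠ 0 ∧ E.coord α = Finsupp.single i a) ∨
     (∃ (i j : E.J) (a c : ℝ), i ≠ j ∧ |a| = 1 ∧ |c| = 1 ∧
        E.coord α = Finsupp.single i a + Finsupp.single j c)) := by
  classical
  by_cases hprop : ∃ i j : E.J, i ≠ j ∧ ∃ c : ℝ, α = c • ((i : V) - j)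
  · refine ⟨?_, Or.inl hprop⟩
    obtain ⟨i, j, hij, c, rfl⟩ := hprop
    exact E.normSq_diff c hij
  have hle := E.normSq_le α
  have hvals : ∀ i : E.J, E.coord α i ≠ 0 → E.coord α i ^ 2 = b.form α α ∨
      (b.form α α = 2 ∧ |E.coord α i| = 1) := by
    intro i hi
    rcases E.root_coord hα hi with ⟨j, hj, c, hc⟩ | ⟨m, n, hm, hn, h1, h2, h3⟩
    · exact absurd ⟨i, j, hj.symm, c, hc⟩ hprop
    have hsq : E.coord α i ^ 2 ≤ E.normSq α :=
      Finset.single_le_sum (f := fun i => E.coord α i ^ 2) (fun _ _ => sq_nonneg _)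
        (Finsupp.mem_support_iff.2 hi)
    have hmR : (0 : ℝ) < m := by exact_mod_cast hm
    have hnR : (0 : ℝ) < n := by exact_mod_cast hn
    rw [← sq_abs, h1] at hsq
    have hmn : (m * n : ℝ) ≤ 2 := by nlinarith
    have hmn' : m * n ≤ 2 := by exact_mod_cast hmn
    rw [← sq_abs, h1]
    have hm2 : m = 1 ∨ m = 2 := by
      have : m ≤ 2 := by nlinarith
      omega
    have hn2 : n = 1 ∨ n = 2 := by
      have : n ≤ 2 := by nlinarith
      omega
    rcases hm2 with rfl | rfl <;> rcases hn2 with rfl | rfl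
    · right; push_cast at h2 ⊢; exact ⟨by linarith, rfl⟩
    · left; push_cast at h2 ⊢; linarith
    · left; push_cast at h2 ⊢; linarith
    · norm_num at hmn'
  by_cases hbig : ∃ i : E.J, E.coord α i ≠ 0 ∧ E.coord α i ^ 2 = b.form α α
  · obtain ⟨i, hi, he⟩ := hbig
    have hsplit : E.normSq α = E.coord α i ^ 2 +
        ∑ k ∈ (E.coord α).support.erase i, E.coord α k ^ 2 :=
      (Finset.add_sum_erase _ _ (Finsupp.mem_support_iff.2 hi)).symm
    have hnn : 0 ≤ ∑ k ∈ (E.coord α).support.erase i, E.coord α k ^ 2 :=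
      Finset.sum_nonneg fun _ _ => sq_nonneg _
    have hz := (Finset.sum_eq_zero_iff_of_nonneg (fun _ _ => sq_nonneg _)).1
      (by linarith : ∑ k ∈ (E.coord α).support.erase i, E.coord α k ^ 2 = 0)
    refine ⟨by linarith, Or.inr (Or.inl ⟨i, _, hi, ?_⟩)⟩
    ext k
    by_cases hk : k = i
    · rw [hk, Finsupp.single_eq_same]
    · rw [Finsupp.single_eq_of_ne hk]
      by_contra hne
      exact hne (pow_eq_zero_iff two_ne_zero |>.1
        (hz k (Finset.mem_erase.2 ⟨hk, Finsupp.mem_support_iff.2 hne⟩)))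
  · push Not at hbig
    have hone : ∀ i : E.J, E.coord α i ≠ 0 → b.form α α = 2 ∧ |E.coord α i| = 1 :=
      fun i hi => (hvals i hi).resolve_left (hbig i hi)
    obtain ⟨i, hi⟩ := Finsupp.ne_iff.1 h0
    have h2 := (hone i hi).1
    have hcard : E.normSq α = (E.coord α).support.card := by
      rw [← nsmul_one, ← Finset.sum_const]
      refine Finset.sum_congr rfl fun k hk => ?_
      rw [← sq_abs, (hone k (Finsupp.mem_support_iff.1 hk)).2, one_pow]
    have hcard2 : (E.coord α).support.card ≤ 2 := by
      rw [hcard, h2] at hle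
      exact_mod_cast hle
    have hcard0 : 0 < (E.coord α).support.card :=
      Finset.card_pos.2 ⟨i, Finsupp.mem_support_iff.2 hi⟩
    have hcard1 : (E.coord α).support.card ≠ 1 := by
      intro h1
      obtain ⟨k, a, ha, hk⟩ := Finsupp.card_support_eq_one'.1 h1
      refine E.coord_ne_single hα h2 k (a := a) ?_ hk
      have := (hone k (by rw [hk]; simpa using ha)).2
      rwa [hk, Finsupp.single_eq_same] at this
    have hc2 : (E.coord α).support.card = 2 := by omega
    refine ⟨by rw [hcard, h2, hc2]; norm_num, Or.inr (Or.inr ?_)⟩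
    obtain ⟨k, l, hkl, hs⟩ := Finset.card_eq_two.1 hc2
    refine ⟨k, l, E.coord α k, E.coord α l, hkl, ?_, ?_, ?_⟩
    · exact (hone k (Finsupp.mem_support_iff.1 (by rw [hs]; simp))).2
    · exact (hone l (Finsupp.mem_support_iff.1 (by rw [hs]; simp))).2
    · ext j
      rw [Finsupp.add_apply]
      by_cases hjk : j = k
      · subst hjk
        rw [Finsupp.single_eq_same, Finsupp.single_eq_of_ne hkl, add_zero]
      by_cases hjl : j = l
      · subst hjl
        rw [Finsupp.single_eq_same, Finsupp.single_eq_of_ne (Ne.symm hkl), zero_add]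
      · rw [Finsupp.single_eq_of_ne hjk, Finsupp.single_eq_of_ne hjl, add_zero]
        refine Finsupp.notMem_support_iff.1 ?_
        rw [hs]; simp [hjk, hjl]

/-- Roots with nonzero coordinate vector attain equality in Bessel's inequality, hence are
orthogonal to roots with zero coordinate vector; irreducibility excludes the latter. -/
theorem coord_root_ne_zero (hR : R.IsIrreducible) {α : V} (hα : α ∈ R.roots) :
    E.coord α ≠ 0 := by
  intro h0
  obtain ⟨i, hi⟩ := E.infinite.nonempty
  obtain ⟨j, hj⟩ := E.exists_notMem {⟨i, hi⟩}
  have hij : i ≠ j := fun h => hj (by simp [h])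
  have hne : E.coord (i - j) ≠ 0 := by
    intro h
    have e := E.coord_diff ⟨i, hi⟩ j
    rw [show ((⟨i, hi⟩ : E.J) : V) - j = i - j from rfl, h, eq_comm, sub_eq_zero] at e
    rw [Finsupp.single_left_inj one_ne_zero] at e
    exact hj (by simp [e])
  obtain ⟨β, hβ, γ, hγ, hn⟩ := hR.2 {β | E.coord β ≠ 0} ⟨⟨_, (E.simplex hi j.2 hij).1⟩, hne⟩
    ⟨⟨α, hα⟩, by simpa using h0⟩
  apply hn
  rw [b.form_eq_zero_iff_coroot]
  exact E.form_eq_zero (E.root_cases β.2 hβ).1 (by simpa using hγ)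

theorem coord_injective (hR : R.IsIrreducible) : Function.Injective E.coord := by
  rw [← LinearMap.ker_eq_bot, LinearMap.ker_eq_bot']
  intro y hy
  have : b.form y = 0 := by
    refine LinearMap.ext_on R.span_roots fun v hv => ?_
    rw [b.symm, LinearMap.zero_apply]
    exact E.form_eq_zero (E.root_cases hv (E.coord_root_ne_zero hR hv)).1 hy
  exact b.eq_zero_of_form_self (by rw [this, LinearMap.zero_apply])

/-- The sum of the coordinates. -/
noncomputable def height : V →ₗ[ℝ] ℝ :=
  (Finsupp.linearCombination ℝ fun _ : E.J => (1 : ℝ)) ∘ₗ E.coord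

theorem height_diff (i j : E.J) : E.height ((i : V) - j) = 0 := by
  simp [height, coord_diff, -map_sub, map_sub (Finsupp.linearCombination ℝ fun _ : E.J => (1 : ℝ))]

theorem height_of_mem {x : V} (hx : x ∈ E.diffSpan) : E.height x = 0 := by
  have : E.diffSpan ≤ LinearMap.ker E.height := by
    refine Submodule.span_le.2 ?_
    rintro _ ⟨i, hi, j, hj, rfl⟩
    exact E.height_diff ⟨i, hi⟩ ⟨j, hj⟩
  exact this hx

theorem mem_of_height (hR : R.IsIrreducible) {x : V} (hx : E.height x = 0) : x ∈ E.diffSpan := by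
  obtain ⟨i₀, hi₀⟩ := E.infinite.nonempty
  have e : x = (E.coord x).sum fun i a => a • ((i : V) - i₀) := by
    apply E.coord_injective hR
    rw [Finsupp.sum, map_sum]
    have : ∀ i : E.J, E.coord (E.coord x i • ((i : V) - i₀)) =
        Finsupp.single i (E.coord x i) - E.coord x i • Finsupp.single ⟨i₀, hi₀⟩ 1 := by
      intro i
      have := E.coord_diff i ⟨i₀, hi₀⟩
      simp only at this
      rw [map_smul, this, smul_sub, Finsupp.smul_single, smul_eq_mul, mul_one]
    simp only [this]
    rw [Finset.sum_sub_distrib, ← Finset.sum_smul]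
    have h1 : ∑ i ∈ (E.coord x).support, E.coord x i = 0 := by
      simpa [height, Finsupp.linearCombination_apply, Finsupp.sum] using hx
    have h2 : ∑ i ∈ (E.coord x).support, Finsupp.single i (E.coord x i) = E.coord x :=
      Finsupp.sum_single _
    rw [h1, h2, zero_smul, sub_zero]
  rw [e]
  exact Submodule.sum_mem _ fun i _ => Submodule.smul_mem _ _
    (Submodule.subset_span ⟨i, i.2, i₀, hi₀, rfl⟩)

theorem height_int {α : V} (hα : α ∈ R.roots) : ∃ n : ℤ, E.height α = n := by
  choose n hn using E.coord_int hα
  exact ⟨∑ i ∈ (E.coord α).support, n i, by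
    simp [height, Finsupp.linearCombination_apply, Finsupp.sum, hn]⟩

theorem coord_diff_left {i j : E.J} (hij : i ≠ j) (c : ℝ) :
    E.coord (c • ((i : V) - j)) i = c := by
  rw [map_smul, coord_diff]
  simp [Finsupp.single_eq_of_ne hij]

theorem eq_diff_of_mem_redRoots (hR : R.IsIrreducible) {γ : V} (hγ : γ ∈ R.redRoots)
    (h0 : E.height γ = 0) : ∃ i j : E.J, i ≠ j ∧ γ = (i : V) - j := by
  have key : ∀ i j : E.J, i ≠ j → ∀ c : ℝ, γ = c • ((i : V) - j) →
      ∃ i j : E.J, i ≠ j ∧ γ = (i : V) - j := by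
    intro i j hij c hc
    have hv : (i : V) ≠ j := fun h => hij (Subtype.ext h)
    obtain ⟨hr, h2⟩ := E.simplex i.2 j.2 hv
    obtain ⟨n, hn⟩ := E.coord_int hγ.1 i
    rw [hc, E.coord_diff_left hij] at hn
    obtain ⟨n', hn'⟩ := R.integral ⟨γ, hγ.1⟩ ⟨_, hr⟩
    have e := b.coroot_mul ⟨γ, hγ.1⟩ ((i : V) - j)
    simp only at hn' e
    rw [hn', hc] at e
    simp only [map_smul, LinearMap.smul_apply, h2, smul_eq_mul] at e
    have hc0 : c ≠ 0 := by
      rintro rfl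
      rw [zero_smul] at hc
      exact ne_zero ⟨γ, hγ.1⟩ hc
    -- Both the coordinate `c` and the Cartan integer `2 / c` are integers; reducedness will exclude
    -- `c = ±2`.
    have e2 : (n' * n : ℝ) = 2 := by
      rw [← hn]
      refine mul_left_cancel₀ (mul_ne_zero two_ne_zero hc0) ?_
      linarith
    have e3 : n' * n = 2 := by exact_mod_cast e2
    have hred : ∀ d : V, d ∈ R.roots → γ ≠ (2 : ℝ) • d := by
      intro d hd h
      apply hγ.2
      rw [h, smul_smul]
      norm_num
      exact hd
    have hdvd : n ∣ 2 := ⟨n', by linarith⟩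
    have hle : n ≤ 2 := Int.le_of_dvd two_pos hdvd
    have hge : -n ≤ 2 := Int.le_of_dvd two_pos ((neg_dvd).2 hdvd)
    have hn0 : n ≠ 0 := by rintro rfl; simp at e3
    have hcases : n = -2 ∨ n = -1 ∨ n = 1 ∨ n = 2 := by omega
    rcases hcases with h | h | h | h <;> rw [h] at hn <;> push_cast at hn <;> rw [hn] at hc
    · exact absurd (by rw [hc]; module) (hred _ (neg_mem hr))
    · exact ⟨j, i, hij.symm, by rw [hc]; module⟩
    · exact ⟨i, j, hij, by rw [hc, one_smul]⟩
    · exact absurd hc (hred _ hr)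
  rcases (E.root_cases hγ.1 (E.coord_root_ne_zero hR hγ.1)).2 with
    ⟨i, j, hij, c, hc⟩ | ⟨i, a, ha, h⟩ | ⟨i, j, a, c, hij, -, -, h⟩
  · exact key i j hij c hc
  · exfalso
    apply ha
    simpa [height, h] using h0
  · refine key i j hij a (E.coord_injective hR ?_)
    have : c = -a := by
      have : a + c = 0 := by
        simpa only [height, h, LinearMap.comp_apply, map_add,
          Finsupp.linearCombination_single, smul_eq_mul, mul_one] using h0
      linarith
    rw [h, map_smul, coord_diff, this, smul_sub, Finsupp.smul_single, Finsupp.smul_single]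
    simp [sub_eq_add_neg]

/-- The base consists of all `i - i₀` for a fixed vertex `i₀`: reflecting `i - i₀` in `j - i₀` gives
`i - j`. -/
theorem exists_isReflectableBase_diffSpan (hR : R.IsIrreducible) :
    ∃ B, R.IsReflectableBase B E.diffSpan := by
  classical
  obtain ⟨v₀, hv₀⟩ := E.infinite.nonempty
  let i₀ : E.J := ⟨v₀, hv₀⟩
  let g : {i : E.J // i ≠ i₀} → V := fun i => (i : V) - i₀
  have hne : ∀ i j : E.J, i ≠ j → (i : V) ≠ j := fun i j hij h => hij (Subtype.ext h)
  have hsimplex : ∀ i j : E.J, i ≠ j → (i : V) - j ∈ R.roots ∧ b.form (i - j) (i - j) = 2 :=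
    fun i j hij => E.simplex i.2 j.2 (hne i j hij)
  have hspan : Submodule.span ℝ (Set.range g) = E.diffSpan := by
    apply le_antisymm
    · refine Submodule.span_mono ?_
      rintro _ ⟨i, rfl⟩
      exact ⟨i, i.1.2, i₀, hv₀, rfl⟩
    · have hmem : ∀ i : E.J, (i : V) - i₀ ∈ Submodule.span ℝ (Set.range g) := by
        intro i
        by_cases h : i = i₀
        · rw [h, sub_self]; exact Submodule.zero_mem _
        · exact Submodule.subset_span ⟨⟨i, h⟩, rfl⟩
      refine Submodule.span_le.2 ?_
      rintro _ ⟨i, hi, j, hj, rfl⟩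
      have := Submodule.sub_mem _ (hmem ⟨i, hi⟩) (hmem ⟨j, hj⟩)
      simpa using this
  refine ⟨Set.range g, ?_, ?_, hspan, ?_⟩
  · rintro _ ⟨i, rfl⟩
    refine ⟨(hsimplex i i₀ i.2).1, fun h => ?_⟩
    obtain ⟨n, hn⟩ := E.coord_int h i
    rw [show g i = (i.1 : V) - i₀ from rfl, E.coord_diff_left i.2] at hn
    have h2 : (2 * n : ℝ) = 1 := by rw [← hn]; norm_num
    have : 2 * n = 1 := by exact_mod_cast h2
    omega
  · apply LinearIndependent.linearIndepOn_id
    rw [linearIndependent_iff']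
    intro s c hsum i hi
    have e := DFunLike.congr_fun (congrArg E.coord hsum) i.1
    rw [map_sum, map_zero, Finsupp.zero_apply, Finsupp.finsetSum_apply,
      Finset.sum_eq_single i] at e
    · rwa [show g i = (i.1 : V) - i₀ from rfl, E.coord_diff_left i.2] at e
    · intro j _ hji
      have h1 : i.1 ≠ j.1 := fun h => hji (Subtype.ext h.symm)
      rw [show g j = (j.1 : V) - i₀ from rfl, map_smul, coord_diff]
      simp [Finsupp.single_eq_of_ne h1, Finsupp.single_eq_of_ne i.2]
    · exact fun h => absurd hi h
  · intro T hT hBT γ hγ hγU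
    obtain ⟨i, j, hij, rfl⟩ := E.eq_diff_of_mem_redRoots hR hγ (E.height_of_mem hγU)
    by_cases hj : j = i₀
    · subst hj
      exact hBT ⟨⟨i, hij⟩, rfl⟩
    by_cases hi : i = i₀
    · subst hi
      rw [← neg_sub]
      exact hT.neg_mem (hsimplex j i₀ hj).1 (hBT ⟨⟨j, hj⟩, rfl⟩)
    · have := hT ⟨_, (hsimplex j i₀ hj).1⟩ ⟨_, (hsimplex i i₀ hi).1⟩ (hBT ⟨⟨j, hj⟩, rfl⟩)
        (hBT ⟨⟨i, hi⟩, rfl⟩)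
      have e := E.simplex.form_sub_sub j.2 i.2 hv₀ hv₀ (hne j i₀ hj) (hne i i₀ hi)
      rw [if_neg (hne j i hij.symm), if_pos rfl, zero_add] at e
      have h1 : R.coroot ⟨_, (hsimplex j i₀ hj).1⟩ ((i : V) - i₀) = 1 := by
        rw [b.coroot_eq]
        simp only [(hsimplex j i₀ hj).2]
        rw [show b.form ((j : V) - i₀) ((i : V) - i₀) = 1 from e]
        norm_num
      simp only at this
      rwa [h1, one_smul, sub_sub_sub_cancel_right] at this

/-- If the integer-valued height is nonzero on some root, it has a least positive value there and
one extension reaches `⊤`; if not, all roots already lie in `diffSpan`. -/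
theorem exists_isReflectableBase_top (E : b.StdCoord) (hR : R.IsIrreducible) :
    ∃ B, R.IsReflectableBase B ⊤ := by
  classical
  obtain ⟨B, hB⟩ := E.exists_isReflectableBase_diffSpan hR
  by_cases h : ∃ n : ℕ, 0 < n ∧ ∃ β ∈ R.roots, E.height β = n
  · refine hB.exists_extend b hR le_top (f := E.height) (fun x hx => E.height_of_mem hx)
      (fun x _ hx => E.mem_of_height hR hx) ?_
    obtain ⟨hpos, β, hβ, hβn⟩ := Nat.find_spec h
    refine ⟨β, hβ, Submodule.mem_top, by rw [hβn]; exact_mod_cast hpos, fun γ hγ _ hγp => ?_⟩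
    obtain ⟨m, hm⟩ := E.height_int hγ
    rw [hm] at hγp ⊢
    have hmp : 0 < m := by exact_mod_cast hγp
    obtain ⟨k, rfl⟩ := Int.eq_ofNat_of_zero_le hmp.le
    rw [hβn]
    have := Nat.find_min' h (m := k) ⟨by exact_mod_cast hmp, γ, hγ, by rw [hm]; simp⟩
    exact_mod_cast this
  · refine ⟨B, ?_⟩
    convert hB
    symm
    rw [← top_le_iff, ← R.span_roots]
    refine Submodule.span_le.2 fun α hα => E.mem_of_height hR ?_
    by_contra hne
    apply h
    obtain ⟨m, hm⟩ := E.height_int hα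
    have hm0 : m ≠ 0 := by
      rintro rfl
      exact hne (by simpa using hm)
    obtain ⟨k, rfl | rfl⟩ := Int.eq_nat_or_neg m
    · exact ⟨k, by omega, α, hα, by simpa using hm⟩
    · exact ⟨k, by omega, -α, neg_mem hα, by rw [map_neg, hm]; simp⟩

end StdCoord

/-! ### Existence of an infinite simplex. -/

variable (b)

/-- A positive multiple of an invariant form. -/
def scale (c : ℝ) (hc : 0 < c) : R.InvariantForm where
  form := c • b.form
  symm x y := by simp [b.symm x y]
  pos x hx := by
    have := b.pos x hx
    simpa using mul_pos hc this
  coroot_mul α x := by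
    have := b.coroot_mul α x
    simp only [LinearMap.smul_apply, smul_eq_mul]
    linear_combination c * this

theorem exists_infinite_neighbours (hR : R.IsIrreducible) (hinf : R.roots.Infinite) :
    ∃ θ : R.roots, {α | α ∈ R.roots ∧ 0 < b.form θ α}.Infinite := by
  by_contra hcon
  push Not at hcon
  have hfin : ∀ θ : R.roots, {α | α ∈ R.roots ∧ b.form θ α ≠ 0}.Finite := by
    intro θ
    refine ((hcon θ).union ((hcon θ).image fun x => -x)).subset ?_
    rintro α ⟨hα, hne⟩
    rcases lt_or_gt_of_ne hne with h | h
    · exact Or.inr ⟨-α, ⟨neg_mem hα, by simpa using h⟩, neg_neg α⟩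
    · exact Or.inl ⟨hα, h⟩
  obtain ⟨a, ha⟩ := hR.1
  have hN := hfin ⟨a, ha⟩
  refine hinf ((hN.biUnion' (t := fun γ hγ => {β | β ∈ R.roots ∧ b.form γ β ≠ 0})
    fun γ hγ => hfin ⟨γ, hγ.1⟩).subset fun β hβ => ?_)
  obtain ⟨γ, h1, h2⟩ := b.exists_nonorthogonal_both hR ⟨a, ha⟩ ⟨β, hβ⟩
  exact Set.mem_iUnion₂.2 ⟨γ, ⟨γ.2, h1⟩, hβ, h2⟩

theorem exists_infinite_homogeneous (hR : R.IsIrreducible) (hinf : R.roots.Infinite) :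
    ∃ (θ : R.roots) (A : Set V) (ℓ t : ℝ), A ⊆ R.roots ∧ A.Infinite ∧ 0 < t ∧
      ∀ α ∈ A, b.form α α = ℓ ∧ b.form θ α = t := by
  obtain ⟨θ, hθ⟩ := b.exists_infinite_neighbours hR hinf
  have hvals : ((fun α => (b.form α α, b.form θ α)) ''
      {α | α ∈ R.roots ∧ 0 < b.form θ α}).Finite := by
    refine ((b.finite_lengths hR).prod (Finset.finite_toSet ((Finset.Icc (1 : ℤ) 4).image
      fun m : ℤ => (m : ℝ) * b.form θ θ / 2))).subset ?_
    rintro _ ⟨α, ⟨hα, hpos⟩, rfl⟩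
    obtain ⟨m, n, hm, hn, -, -, hmn, e, -⟩ := b.exists_cartan (α := θ) (β := ⟨α, hα⟩) hpos
    refine ⟨⟨⟨α, hα⟩, rfl⟩, ?_⟩
    simp only [Finset.coe_image, Set.mem_image, Finset.mem_coe, Finset.mem_Icc]
    exact ⟨m, ⟨by omega, by nlinarith⟩, by rw [e]; ring⟩
  have : ∃ p : ℝ × ℝ, ({α | α ∈ R.roots ∧ 0 < b.form θ α} ∩
      (fun α => (b.form α α, b.form θ α)) ⁻¹' {p}).Infinite := by
    by_contra hcon
    push Not at hcon
    exact hθ (Set.Finite.of_finite_fibers _ hvals fun p _ => hcon p)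
  obtain ⟨⟨ℓ, t⟩, hp⟩ := this
  obtain ⟨α, hα⟩ := hp.nonempty
  refine ⟨θ, _, ℓ, t, fun x hx => hx.1.1, hp, ?_, fun x hx => ?_⟩
  · have := hα.2
    simp only [Set.mem_preimage, Set.mem_singleton_iff, Prod.mk.injEq] at this
    rw [← this.2]; exact hα.1.2
  · have := hx.2
    simpa only [Set.mem_preimage, Set.mem_singleton_iff, Prod.mk.injEq] using this

/-- Cauchy–Schwarz for `θ` and the sum over `T`, whose squared norm is at most `ℓ * card T` because
the mixed terms are nonpositive. -/
theorem card_le_of_nonpos {T : Finset V} {θ : V} {ℓ t : ℝ} (hℓ : 0 ≤ ℓ)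
    (hT : ∀ x ∈ T, ∀ y ∈ T, x ≠ y → b.form x y ≤ 0)
    (h : ∀ x ∈ T, b.form x x = ℓ ∧ b.form θ x = t) : t ^ 2 * T.card ≤ b.form θ θ * ℓ := by
  classical
  rcases T.eq_empty_or_nonempty with rfl | hne
  · simpa using mul_nonneg (b.nonneg θ) hℓ
  have hcard : 0 < (T.card : ℝ) := by exact_mod_cast hne.card_pos
  have h1 : b.form θ (∑ x ∈ T, x) = T.card * t := by
    rw [map_sum, Finset.sum_congr rfl fun x hx => (h x hx).2, Finset.sum_const, nsmul_eq_mul]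
  have h2 : b.form (∑ x ∈ T, x) (∑ x ∈ T, x) ≤ T.card * ℓ := by
    rw [map_sum, ← nsmul_eq_mul, ← Finset.sum_const]
    refine Finset.sum_le_sum fun x hx => ?_
    rw [b.symm, map_sum, ← Finset.add_sum_erase T _ hx, (h x hx).1]
    have : ∑ y ∈ T.erase x, b.form x y ≤ 0 := Finset.sum_nonpos fun y hy =>
      hT x hx y (Finset.mem_of_mem_erase hy) (Finset.ne_of_mem_erase hy).symm
    linarith
  have hcs := b.sq_le θ (∑ x ∈ T, x)
  rw [h1] at hcs
  have h3 := hcs.trans (mul_le_mul_of_nonneg_left h2 (b.nonneg θ))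
  have : (T.card : ℝ) * (t ^ 2 * T.card) ≤ T.card * (b.form θ θ * ℓ) := by linarith
  exact le_of_mul_le_mul_left this hcard

/-- A Ramsey argument. Sets with pairwise nonpositive products have bounded size, so enlarging such
a `T`, while infinitely many elements stay nonpositive to all of it, must stop. Then each of these
elements is nonpositive to only finitely many of the others, and a maximal subset with pairwise
positive products is infinite. -/
theorem exists_infinite_clique {θ : V} {A : Set V} {ℓ t : ℝ} (hA : A ⊆ R.roots)
    (hinf : A.Infinite) (ht : 0 < t) (h : ∀ α ∈ A, b.form α α = ℓ ∧ b.form θ α = t) :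
    ∃ C ⊆ A, C.Infinite ∧ C.Pairwise fun x y => 0 < b.form x y := by
  classical
  let good : Finset V → Prop := fun T => ↑T ⊆ A ∧ (∀ x ∈ T, ∀ y ∈ T, x ≠ y → b.form x y ≤ 0) ∧
    {a | a ∈ A ∧ ∀ x ∈ T, b.form x a ≤ 0}.Infinite
  have hterm : ∃ T, good T ∧ ∀ a ∈ A, (∀ x ∈ T, b.form x a ≤ 0) →
      {a' | a' ∈ A ∧ (∀ x ∈ T, b.form x a' ≤ 0) ∧ b.form a a' ≤ 0}.Finite := by
    by_contra hcon
    push Not at hcon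
    have hall : ∀ n : ℕ, ∃ T, good T ∧ T.card = n := by
      intro n
      induction n with
      | zero => exact ⟨∅, ⟨by simp, by simp, by simpa using hinf⟩, rfl⟩
      | succ n ih =>
        obtain ⟨T, hT, hn⟩ := ih
        obtain ⟨a, ha, haT, hai⟩ := hcon T hT
        have haT' : a ∉ T := fun hmem => (b.form_pos ⟨a, hA ha⟩).not_ge (haT a hmem)
        refine ⟨insert a T, ⟨?_, ?_, ?_⟩, by rw [Finset.card_insert_of_notMem haT', hn]⟩
        · rw [Finset.coe_insert]; exact Set.insert_subset ha hT.1
        · intro x hx y hy hxy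
          rcases Finset.mem_insert.1 hx with hxa | hxT <;>
            rcases Finset.mem_insert.1 hy with hya | hyT
          · exact absurd (hxa.trans hya.symm) hxy
          · rw [hxa, b.symm]; exact haT y hyT
          · rw [hya]; exact haT x hxT
          · exact hT.2.1 x hxT y hyT hxy
        · refine hai.mono fun a' ha' => ⟨ha'.1, fun x hx => ?_⟩
          rcases Finset.mem_insert.1 hx with rfl | hx
          · exact ha'.2.2
          · exact ha'.2.1 x hx
    obtain ⟨n, hn⟩ := exists_nat_gt (b.form θ θ * ℓ / t ^ 2)
    obtain ⟨T, hT, rfl⟩ := hall n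
    obtain ⟨a, ha⟩ := hinf.nonempty
    have := b.card_le_of_nonpos ((h a ha).1 ▸ b.nonneg a) hT.2.1 fun x hx => h x (hT.1 hx)
    rw [div_lt_iff₀ (by positivity)] at hn
    linarith
  obtain ⟨T, ⟨-, -, hD⟩, hfin⟩ := hterm
  obtain ⟨C, hC⟩ := zorn_subset {C | C ⊆ {a | a ∈ A ∧ ∀ x ∈ T, b.form x a ≤ 0} ∧
      C.Pairwise fun x y => 0 < b.form x y} (fun c hc hchain =>
    ⟨⋃₀ c, ⟨Set.sUnion_subset fun s hs => (hc hs).1,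
      (Set.pairwise_sUnion hchain.directedOn).2 fun s hs => (hc hs).2⟩,
      fun s hs => Set.subset_sUnion_of_mem hs⟩)
  refine ⟨C, fun x hx => (hC.prop.1 hx).1, fun hCfin => ?_, hC.prop.2⟩
  obtain ⟨d, hd, hdn⟩ := hD.exists_notMem_finite (hCfin.union (hCfin.biUnion'
    (t := fun a _ => {a' | a' ∈ A ∧ (∀ x ∈ T, b.form x a' ≤ 0) ∧ b.form a a' ≤ 0})
    fun a ha => hfin a (hC.prop.1 ha).1 (hC.prop.1 ha).2))
  simp only [Set.mem_union, Set.mem_iUnion, not_or, not_exists] at hdn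
  refine hdn.1 (hC.le_of_ge (y := insert d C) ⟨Set.insert_subset hd hC.prop.1, ?_⟩
    (Set.subset_insert d C) (Set.mem_insert d C))
  refine hC.prop.2.insert fun c hc _ => ?_
  have hpos : 0 < b.form c d := by
    by_contra hneg
    exact hdn.2 c hc ⟨hd.1, hd.2, not_lt.1 hneg⟩
  exact ⟨by rwa [b.symm], hpos⟩

/-- Distinct roots of equal length with positive product have Cartan integers `1`, so their
difference is a root of the same length; scaling normalises it. -/
theorem exists_infinite_simplex (b : R.InvariantForm) (hR : R.IsIrreducible) (hinf : R.roots.Infinite) :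
    ∃ (b' : R.InvariantForm) (J : Set V), b'.IsSimplex J ∧ J.Infinite := by
  obtain ⟨θ, A, ℓ, t, hA, hAinf, ht, h⟩ := b.exists_infinite_homogeneous hR hinf
  obtain ⟨C, hCA, hC, hpair⟩ := b.exists_infinite_clique hA hAinf ht h
  obtain ⟨a, ha⟩ := hAinf.nonempty
  have hℓ : 0 < ℓ := by rw [← (h a ha).1]; exact b.form_pos ⟨a, hA ha⟩
  refine ⟨b.scale (2 / ℓ) (by positivity), C, fun x hx y hy hxy => ?_, hC⟩
  have hpos := hpair hx hy hxy
  have hxR := hA (hCA hx)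
  have hyR := hA (hCA hy)
  refine ⟨b.sub_mem_roots hxR hyR hpos hxy, ?_⟩
  obtain ⟨m, n, hm, hn, -, -, hmn, em, en, h4⟩ :=
    b.exists_cartan (α := ⟨x, hxR⟩) (β := ⟨y, hyR⟩) hpos
  simp only at em en h4
  have hxl := (h x (hCA hx)).1
  have hyl := (h y (hCA hy)).1
  rw [hxl] at em
  rw [hyl] at en
  have hmn' : m = n := by
    have : (m : ℝ) = n := mul_right_cancel₀ hℓ.ne' (em.trans en.symm)
    exact_mod_cast this
  subst hmn'
  have hm1 : m = 1 := by
    by_contra hne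
    have hm2 : m = 2 := by nlinarith [show 2 ≤ m by omega]
    subst hm2
    have := h4 (by norm_num)
    apply hxy
    simpa using this.symm
  subst hm1
  simp only [scale, LinearMap.smul_apply, map_sub, LinearMap.sub_apply, smul_eq_mul, hxl, hyl,
    b.symm y x]
  push_cast at em
  field_simp
  linarith

end InvariantForm

/-! ### The root lattice is free on a reflectable base. -/

theorem IsIrreducible.exists_isReflectableBase (hR : R.IsIrreducible) :
    ∃ B, R.IsReflectableBase B ⊤ := by
  obtain ⟨b⟩ := hR.exists_invariantForm
  by_cases hfin : R.roots.Finite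
  · exact exists_isReflectableBase_of_finite b hR hfin
  · obtain ⟨b', J, hJ, hinf⟩ := b.exists_infinite_simplex hR hfin
    obtain ⟨E⟩ := InvariantForm.exists_stdCoord hJ hinf
    exact E.exists_isReflectableBase_top hR

theorem mem_redRoots_half {α : V} (hα : α ∈ R.roots) (h : (2⁻¹ : ℝ) • α ∈ R.roots) :
    (2⁻¹ : ℝ) • α ∈ R.redRoots := by
  refine ⟨h, fun h4 => ?_⟩
  obtain ⟨n, hn⟩ := R.integral ⟨α, hα⟩ ⟨_, h4⟩
  have h2 := R.coroot_self ⟨α, hα⟩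
  simp only at hn h2
  rw [map_smul, map_smul, h2] at hn
  have h2 : (2 * n : ℝ) = 1 := by rw [← hn]; norm_num
  have : 2 * n = 1 := by exact_mod_cast h2
  omega

/-- The ℤ-span of `B` is closed under reflections by integrality, so it contains the reduced roots;
any other root is twice a reduced one. -/
theorem IsReflectableBase.mem_span_int {B : Set V} (hB : R.IsReflectableBase B ⊤)
    (x : R.rootLattice) : (x : V) ∈ Submodule.span ℤ (Set.range (Subtype.val : B → V)) := by
  rw [Subtype.range_coe]
  have hred : ∀ γ ∈ R.redRoots, γ ∈ Submodule.span ℤ B := by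
    intro γ hγ
    refine hB.mem_of_isReflClosed (Submodule.span ℤ B) (fun α β hα hβ => ?_)
      Submodule.subset_span γ hγ Submodule.mem_top
    obtain ⟨n, hn⟩ := R.integral α β
    rw [hn, Int.cast_smul_eq_zsmul]
    exact Submodule.sub_mem _ hβ (Submodule.smul_mem _ _ hα)
  have hle : R.rootLattice ≤ (Submodule.span ℤ B).toAddSubgroup := by
    refine (AddSubgroup.closure_le _).2 fun α hα => ?_
    by_cases h : (2⁻¹ : ℝ) • α ∈ R.roots
    · have := hred _ (mem_redRoots_half hα h)
      have h2 := Submodule.add_mem _ this this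
      rwa [← add_smul, show (2⁻¹ : ℝ) + 2⁻¹ = 1 by norm_num, one_smul] at h2
    · exact hred α ⟨hα, h⟩
  exact hle x.2

theorem IsReflectableBase.exists_hom {B : Set V} (hB : R.IsReflectableBase B ⊤) {G : Type*}
    [AddCommGroup G] (g : B → G) :
    ∃ s : R.rootLattice →+ G, ∀ (β : B) (x : R.rootLattice), (x : V) = β → s x = g β := by
  have hli : LinearIndependent ℤ (Subtype.val : B → V) :=
    LinearIndependent.restrict_scalars (R := ℤ) (K := ℝ) (fun m n h => by simpa using h)
      hB.linearIndepOn
  let c : R.rootLattice →+ Submodule.span ℤ (Set.range (Subtype.val : B → V)) :=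
    { toFun := fun x => ⟨x, hB.mem_span_int x⟩
      map_zero' := rfl
      map_add' := fun _ _ => rfl }
  refine ⟨(((Module.Basis.span hli).constr ℤ g).toAddMonoidHom).comp c, fun β x hx => ?_⟩
  have : c x = Module.Basis.span hli β := by
    apply Subtype.ext
    rw [Module.Basis.span_apply]
    exact hx
  rw [AddMonoidHom.comp_apply, this]
  exact (Module.Basis.span hli).constr_basis ℤ g β

theorem cartanInt_self (μ : R.rootLattice) (hμ : (μ : V) ∈ R.roots) :
    R.cartanInt μ ⟨μ, hμ⟩ = 2 := by
  have h := R.cartanInt_cast μ ⟨μ, hμ⟩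
  rw [R.coroot_self ⟨μ, hμ⟩] at h
  exact_mod_cast h

theorem cartanInt_neg (ν : R.rootLattice) (μ : R.roots) :
    R.cartanInt (-ν) μ = - R.cartanInt ν μ := by
  have h : ((R.cartanInt (-ν) μ : ℤ) : ℝ) = ((- R.cartanInt ν μ : ℤ) : ℝ) := by
    rw [Int.cast_neg, R.cartanInt_cast, R.cartanInt_cast]; simp
  exact_mod_cast h

theorem cartanInt_add (ν ν' : R.rootLattice) (μ : R.roots) :
    R.cartanInt (ν + ν') μ = R.cartanInt ν μ + R.cartanInt ν' μ := by
  have h : ((R.cartanInt (ν + ν') μ : ℤ) : ℝ) =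
      ((R.cartanInt ν μ + R.cartanInt ν' μ : ℤ) : ℝ) := by
    rw [Int.cast_add, R.cartanInt_cast, R.cartanInt_cast, R.cartanInt_cast]; simp
  exact_mod_cast h

theorem eq_of_cartanInt_eq (b : R.InvariantForm) {ν ν' : R.rootLattice}
    (h : ∀ μ : R.roots, R.cartanInt ν μ = R.cartanInt ν' μ) : ν = ν' := by
  rw [← sub_eq_zero]
  apply Subtype.ext
  apply b.eq_zero_of_form_self
  have : b.form ((ν - ν' : R.rootLattice) : V) = 0 := by
    refine LinearMap.ext_on R.span_roots fun v hv => ?_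
    rw [b.symm, LinearMap.zero_apply]
    refine (b.form_eq_zero_iff_coroot ⟨v, hv⟩ _).1 ?_
    rw [AddSubgroup.coe_sub, map_sub, ← R.cartanInt_cast, ← R.cartanInt_cast, h, sub_self]
  rw [this, LinearMap.zero_apply]

/-- The `α`-string through `β` is finite. -/
theorem exists_notMem_string {α : R.rootLattice} (hα : (α : V) ∈ R.roots) (β : R.rootLattice) :
    ∃ k : ℕ, ((β + k • α : R.rootLattice) : V) ∉ R.roots ∧ β + k • α ≠ 0 := by
  classical
  by_contra hcon
  push Not at hcon
  have hinj : Function.Injective fun k : ℕ => ((β + k • α : R.rootLattice) : V) := by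
    intro k l h
    have h1 : k • (α : V) = l • (α : V) := by simpa using h
    rw [← Nat.cast_smul_eq_nsmul ℝ, ← Nat.cast_smul_eq_nsmul ℝ] at h1
    have := smul_left_injective ℝ (ne_zero ⟨_, hα⟩) h1
    exact_mod_cast this
  have hfin := (R.locallyFinite (Submodule.span ℝ (({(α : V), (β : V)} : Finset V) : Set V))
    inferInstance).insert 0
  refine Set.infinite_range_of_injective hinj (hfin.subset ?_)
  rintro _ ⟨k, rfl⟩
  by_cases h : ((β + k • α : R.rootLattice) : V) ∈ R.roots
  · refine Or.inr ⟨h, ?_⟩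
    simp only [AddSubgroup.coe_add, AddSubgroup.coe_nsmul]
    exact Submodule.add_mem _ (Submodule.subset_span (by simp))
      (Submodule.smul_of_tower_mem _ _ (Submodule.subset_span (by simp)))
  · left
    simp only [hcon k h, AddSubgroup.coe_zero]

end LocallyFiniteRootSystem

/-! ### Representations of `sl₂`. -/

section Sl2

variable {F : Type*} [Field F] {M : Type*} [AddCommGroup M] [Module F M]
  {e f h : Module.End F M}

theorem sl2_pow_apply (hhf : h * f - f * h = (-2 : F) • f) {n : F} {z : M} (hz : h z = n • z)
    (k : ℕ) : h ((f ^ k) z) = (n - 2 * k) • (f ^ k) z := by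
  induction k with
  | zero => simp [hz]
  | succ k ih =>
    have := LinearMap.congr_fun hhf ((f ^ k) z)
    simp only [LinearMap.sub_apply, Module.End.mul_apply, LinearMap.smul_apply, ih, map_smul] at this
    rw [pow_succ', Module.End.mul_apply, sub_eq_iff_eq_add.1 this]
    push_cast
    module

theorem sl2_comm_pow_apply (hef : e * f - f * e = h) (hhf : h * f - f * h = (-2 : F) • f) {n : F}
    {z : M} (hz : h z = n • z) (k : ℕ) :
    e ((f ^ (k + 1)) z) = (f ^ (k + 1)) (e z) + ((k + 1) * (n - k)) • (f ^ k) z := by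
  have hstep : ∀ w, e (f w) = f (e w) + h w := by
    intro w
    rw [← hef, LinearMap.sub_apply, Module.End.mul_apply, Module.End.mul_apply]; abel
  induction k with
  | zero => simp [hstep, hz]
  | succ k ih =>
    rw [pow_succ' f (k + 1), Module.End.mul_apply, hstep, ih, sl2_pow_apply hhf hz,
      Module.End.mul_apply, map_add, map_smul, pow_succ' f k, Module.End.mul_apply,
      Module.End.mul_apply]
    push_cast
    module

/-- In a module over `sl₂`, the `n`-th power of `f` is injective on the locally `e`-nilpotent
vectors of weight `n`. -/
theorem sl2_eq_zero [CharZero F] (hef : e * f - f * e = h) (hhe : h * e - e * h = (2 : F) • e)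
    (hhf : h * f - f * h = (-2 : F) • f) (r : ℕ) (n : ℕ) {z : M} (hz : h z = (n : F) • z)
    (hr : (e ^ r) z = 0) (hn : (f ^ n) z = 0) : z = 0 := by
  induction r generalizing n z with
  | zero => simpa using hr
  | succ r ih =>
    -- At `k = n` the scalar in the commutation formula vanishes, so `f ^ (n + 1)` kills `e z`. This
    -- vector has weight `n + 2`, and the induction on `r` applies to it.
    have hez : e z = 0 := by
      have h1 := sl2_comm_pow_apply hef hhf hz n
      rw [sub_self, mul_zero, zero_smul, add_zero, pow_succ', Module.End.mul_apply, hn, map_zero,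
        map_zero] at h1
      refine ih (n + 2) (z := e z) ?_ ?_ ?_
      · have := LinearMap.congr_fun hhe z
        simp only [LinearMap.sub_apply, Module.End.mul_apply, LinearMap.smul_apply, hz,
          map_smul] at this
        rw [sub_eq_iff_eq_add.1 this]
        push_cast
        module
      · rwa [← Module.End.mul_apply, ← pow_succ]
      · rw [show n + 2 = (n + 1) + 1 from rfl, pow_succ' f (n + 1), Module.End.mul_apply,
          pow_succ' f n, ← h1, map_zero]
    -- Now `z` is killed by `e`, and applying `e` strips off one power of `f` at a time with a
    -- nonzero scalar.
    have hdown : ∀ k ≤ n, (f ^ (n - k)) z = 0 := by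
      intro k
      induction k with
      | zero => intro _; simpa using hn
      | succ k ihk =>
        intro hk
        have h1 := sl2_comm_pow_apply hef hhf hz (n - (k + 1))
        rw [show n - (k + 1) + 1 = n - k by omega, ihk (by omega), hez, map_zero, map_zero,
          zero_add, eq_comm, smul_eq_zero] at h1
        refine h1.resolve_left (mul_ne_zero (Nat.cast_add_one_ne_zero _) ?_)
        rw [Nat.cast_sub hk]
        push_cast
        rw [sub_sub_cancel]
        exact_mod_cast Nat.succ_ne_zero k
    simpa using hdown n le_rfl

end Sl2

/-! ### Nonvanishing components of a Lie torus, and isotopes. -/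

section LieTorus

variable {F : Type*} [Field F] {V : Type*} [AddCommGroup V] [Module ℝ V]
  {G : Type*} [AddCommGroup G] {L : Type*} [LieRing L] [LieAlgebra F L]
  {R : LocallyFiniteRootSystem V} {𝓛 : R.rootLattice → G → Submodule F L}

namespace IsGeneralLieTorus

theorem exists_ne_bot (h𝓛 : IsGeneralLieTorus R 𝓛) {μ : R.rootLattice} (hμ : (μ : V) ∈ R.roots) :
    ∃ g, 𝓛 μ g ≠ ⊥ := by
  by_contra hcon
  push Not at hcon
  exact h𝓛.ne_bot μ hμ (by simp [hcon])

theorem mem_or_eq_zero (h𝓛 : IsGeneralLieTorus R 𝓛) {μ : R.rootLattice} {g : G} {x : L}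
    (hx : x ∈ 𝓛 μ g) (h0 : x ≠ 0) : (μ : V) ∈ R.roots ∨ μ = 0 := by
  by_contra hcon
  push Not at hcon
  rw [h𝓛.eq_bot μ g hcon.1 hcon.2] at hx
  exact h0 ((Submodule.mem_bot F).1 hx)

theorem exists_division (h𝓛 : IsGeneralLieTorus R 𝓛) {μ : R.rootLattice}
    (hμ : (μ : V) ∈ R.roots) {g : G} {x : L} (hx : x ∈ 𝓛 μ g) (h0 : x ≠ 0) :
    ∃ y ∈ 𝓛 (-μ) (-g), ∀ (ν : R.rootLattice) (h : G), ∀ z ∈ 𝓛 ν h,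
      ⁅⁅x, y⁆, z⁆ = (R.cartanInt ν ⟨(μ : V), hμ⟩ : F) • z := by
  obtain ⟨y, hy, h⟩ := h𝓛.division μ hμ g x hx h0
  refine ⟨y, hy, fun ν k z hz => ?_⟩
  by_cases hz0 : z = 0
  · simp [hz0]
  rw [h ν (h𝓛.mem_or_eq_zero hz hz0) k z hz, Int.cast_smul_eq_zsmul]

/-- The elements `[x, y]` of (LT3) act on each component by a scalar, so any nonzero component of
`w` has the eigenvalues of `w`; characteristic zero recovers the integers. -/
theorem exists_component_of_eigenvector [CharZero F] (h𝓛 : IsGeneralLieTorus R 𝓛) {w : L}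
    (hw : w ≠ 0) {ν : R.rootLattice}
    (h : ∀ (μ : R.roots) (H : L), (∀ (ν : R.rootLattice) (h : G), ∀ z ∈ 𝓛 ν h,
      ⁅H, z⁆ = (R.cartanInt ν μ : F) • z) → ⁅H, w⁆ = (R.cartanInt ν μ : F) • w) :
    ∃ ν' : R.rootLattice, ((ν' : V) ∈ R.roots ∨ ν' = 0) ∧
      ∀ μ : R.roots, R.cartanInt ν' μ = R.cartanInt ν μ := by
  classical
  have hint : DirectSum.IsInternal (fun p : R.rootLattice × G => 𝓛 p.1 p.2) := by
    convert h𝓛.isInternal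
  obtain ⟨c, rfl⟩ := hint.2 w
  have hc : c ≠ 0 := by
    rintro rfl
    exact hw (map_zero _)
  obtain ⟨p, hp⟩ := DFinsupp.ne_iff.1 hc
  refine ⟨p.1, h𝓛.mem_or_eq_zero (c p).2 fun h => hp (Subtype.ext h), fun μ => ?_⟩
  have hμ : ((⟨μ, AddSubgroup.subset_closure μ.2⟩ : R.rootLattice) : V) ∈ R.roots := μ.2
  obtain ⟨g, hg⟩ := h𝓛.exists_ne_bot hμ
  obtain ⟨x, hx, hx0⟩ := Submodule.exists_mem_ne_zero_of_ne_bot hg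
  obtain ⟨y, -, hy⟩ := h𝓛.exists_division hμ hx hx0
  let A : (DirectSum (R.rootLattice × G) fun p => 𝓛 p.1 p.2) →ₗ[F]
      (DirectSum (R.rootLattice × G) fun p => 𝓛 p.1 p.2) :=
    DirectSum.lmap fun p => (R.cartanInt p.1 μ : F) • LinearMap.id
  have hA : (DirectSum.coeLinearMap fun p : R.rootLattice × G => 𝓛 p.1 p.2) ∘ₗ A =
      (LieAlgebra.ad F L ⁅x, y⁆).comp
        (DirectSum.coeLinearMap fun p : R.rootLattice × G => 𝓛 p.1 p.2) := by
    refine DirectSum.linearMap_ext F fun p => ?_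
    ext z
    simp only [LinearMap.comp_apply, A, DirectSum.lmap_lof, DirectSum.coeLinearMap_lof,
      LieAlgebra.ad_apply, LinearMap.smul_apply, LinearMap.id_apply, Submodule.coe_smul]
    exact (hy p.1 p.2 z z.2).symm
  have h1 := h μ _ hy
  have h2 := LinearMap.congr_fun hA c
  simp only [LinearMap.comp_apply, LieAlgebra.ad_apply] at h2
  have h3 : (DirectSum.coeLinearMap fun p : R.rootLattice × G => 𝓛 p.1 p.2) (A c) =
      (DirectSum.coeLinearMap fun p : R.rootLattice × G => 𝓛 p.1 p.2)
        ((R.cartanInt ν μ : F) • c) := by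
    rw [h2, map_smul]
    exact h1
  have h4 := DFunLike.congr_fun (hint.1 h3) p
  rw [DirectSum.lmap_apply, LinearMap.smul_apply, LinearMap.id_apply] at h4
  have h5 : ((R.cartanInt p.1 μ : F) - R.cartanInt ν μ) • c p = 0 := by
    rw [sub_smul, h4]
    exact sub_self _
  have h6 := (smul_eq_zero.1 h5).resolve_right hp
  exact_mod_cast sub_eq_zero.1 h6

/-- (LT1) is silent when `μ + ν` is neither a root nor zero. A nonzero bracket would have the Cartan
integers of `μ + ν`, and these determine the weight, so it must vanish there. -/
theorem lie_mem' [CharZero F] (h𝓛 : IsGeneralLieTorus R 𝓛) (b : R.InvariantForm)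
    {μ ν : R.rootLattice} {g h : G} {x y : L} (hx : x ∈ 𝓛 μ g) (hy : y ∈ 𝓛 ν h) :
    ⁅x, y⁆ ∈ 𝓛 (μ + ν) (g + h) := by
  by_cases h0 : ⁅x, y⁆ = 0
  · rw [h0]; exact Submodule.zero_mem _
  have hx0 : x ≠ 0 := by rintro rfl; simp at h0
  have hy0 : y ≠ 0 := by rintro rfl; simp at h0
  refine h𝓛.lie_mem μ ν (h𝓛.mem_or_eq_zero hx hx0) (h𝓛.mem_or_eq_zero hy hy0) ?_ g h x hx y hy
  obtain ⟨ν', h1, h2⟩ := h𝓛.exists_component_of_eigenvector h0 (ν := μ + ν) fun ρ H hH => by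
    rw [leibniz_lie, hH μ g x hx, hH ν h y hy, R.cartanInt_add]
    push_cast
    rw [smul_lie, lie_smul, add_smul]
  rwa [← R.eq_of_cartanInt_eq b h2]

theorem ad_pow_mem [CharZero F] (h𝓛 : IsGeneralLieTorus R 𝓛) (b : R.InvariantForm)
    {μ ν : R.rootLattice} {g h : G} {x y : L} (hx : x ∈ 𝓛 μ g) (hy : y ∈ 𝓛 ν h) (k : ℕ) :
    (LieAlgebra.ad F L x ^ k) y ∈ 𝓛 (ν + k • μ) (h + k • g) := by
  induction k with
  | zero => simpa using hy
  | succ k ih =>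
    have := h𝓛.lie_mem' b hx ih
    rw [pow_succ', Module.End.mul_apply, LieAlgebra.ad_apply]
    convert this using 2
    · rw [succ_nsmul]; abel
    · rw [succ_nsmul]; abel

theorem exists_ad_pow_eq_zero [CharZero F] (h𝓛 : IsGeneralLieTorus R 𝓛) (b : R.InvariantForm)
    {μ ν : R.rootLattice} (hμ : (μ : V) ∈ R.roots) {g h : G} {x y : L} (hx : x ∈ 𝓛 μ g)
    (hy : y ∈ 𝓛 ν h) : ∃ k : ℕ, (LieAlgebra.ad F L x ^ k) y = 0 := by
  obtain ⟨k, h1, h2⟩ := R.exists_notMem_string hμ ν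
  have := h𝓛.ad_pow_mem b hx hy k
  rw [h𝓛.eq_bot _ _ h1 h2] at this
  exact ⟨k, (Submodule.mem_bot F).1 this⟩

/-- Under the `sl₂`-triple of `x` and `y`, `z` has weight `n = ⟨ν, μ⟩`. For `n ≥ 0` the `n`-th power
of `ad y` does not kill `z` and takes it to the reflected component; for `n ≤ 0` the roles of `x`
and `y` are exchanged. -/
theorem reflection_ne_bot [CharZero F] (h𝓛 : IsGeneralLieTorus R 𝓛) (b : R.InvariantForm)
    {μ ν : R.rootLattice} (hμ : (μ : V) ∈ R.roots) {g h : G} (hg : 𝓛 μ g ≠ ⊥) (hh : 𝓛 ν h ≠ ⊥) :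
    𝓛 (ν - R.cartanInt ν ⟨μ, hμ⟩ • μ) (h - R.cartanInt ν ⟨μ, hμ⟩ • g) ≠ ⊥ := by
  obtain ⟨x, hx, hx0⟩ := Submodule.exists_mem_ne_zero_of_ne_bot hg
  obtain ⟨z, hz, hz0⟩ := Submodule.exists_mem_ne_zero_of_ne_bot hh
  obtain ⟨y, hy, hH⟩ := h𝓛.exists_division hμ hx hx0
  have hxx := hH μ g x hx
  have hyy := hH (-μ) (-g) y hy
  rw [R.cartanInt_neg, R.cartanInt_self μ hμ] at hyy
  rw [R.cartanInt_self μ hμ] at hxx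
  push_cast at hxx hyy
  have hzz := hH ν h z hz
  have hneg : ((-μ : R.rootLattice) : V) ∈ R.roots := by
    rw [AddSubgroup.coe_neg]; exact LocallyFiniteRootSystem.neg_mem hμ
  have hef : LieAlgebra.ad F L x * LieAlgebra.ad F L y - LieAlgebra.ad F L y * LieAlgebra.ad F L x =
      LieAlgebra.ad F L ⁅x, y⁆ := by
    ext w
    simp
  have had : ∀ u c, ⁅⁅x, y⁆, u⁆ = (c : F) • u → LieAlgebra.ad F L ⁅x, y⁆ * LieAlgebra.ad F L u -
      LieAlgebra.ad F L u * LieAlgebra.ad F L ⁅x, y⁆ = c • LieAlgebra.ad F L u := by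
    intro u c hu
    ext w
    simp only [LinearMap.sub_apply, Module.End.mul_apply, LieAlgebra.ad_apply,
      LinearMap.smul_apply, ← lie_lie, hu, smul_lie]
  have hhe := had x 2 hxx
  have hhf := had y (-2) hyy
  rcases le_total 0 (R.cartanInt ν ⟨μ, hμ⟩) with hn | hn
  · obtain ⟨n, hn⟩ := Int.eq_ofNat_of_zero_le hn
    obtain ⟨r, hr⟩ := h𝓛.exists_ad_pow_eq_zero b hμ hx hz
    have hmem := h𝓛.ad_pow_mem b hy hz n
    intro hbot
    rw [hn, natCast_zsmul, natCast_zsmul, sub_eq_add_neg, sub_eq_add_neg, ← smul_neg, ← smul_neg]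
      at hbot
    rw [hbot, Submodule.mem_bot] at hmem
    rw [hn] at hzz
    exact hz0 (sl2_eq_zero hef hhe hhf r n (by simpa using hzz) hr hmem)
  · obtain ⟨n, hn⟩ := Int.eq_ofNat_of_zero_le (neg_nonneg.2 hn)
    have hn' : R.cartanInt ν ⟨μ, hμ⟩ = -n := by omega
    obtain ⟨r, hr⟩ := h𝓛.exists_ad_pow_eq_zero b hneg hy hz
    have hmem := h𝓛.ad_pow_mem b hx hz n
    intro hbot
    rw [hn', neg_smul, neg_smul, sub_neg_eq_add, sub_neg_eq_add, natCast_zsmul, natCast_zsmul]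
      at hbot
    rw [hbot, Submodule.mem_bot] at hmem
    rw [hn'] at hzz
    refine hz0 (sl2_eq_zero (e := LieAlgebra.ad F L y) (f := LieAlgebra.ad F L x)
      (h := -LieAlgebra.ad F L ⁅x, y⁆) ?_ ?_ ?_ r n ?_ hr hmem)
    · rw [← hef]; abel
    · rw [neg_mul, mul_neg, sub_neg_eq_add, ← neg_inj, ← neg_smul, ← hhf]; abel
    · rw [neg_mul, mul_neg, sub_neg_eq_add, ← neg_inj, ← neg_smul, neg_neg, ← hhe]; abel
    · rw [LinearMap.neg_apply, LieAlgebra.ad_apply, hzz]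
      push_cast
      rw [neg_smul, neg_neg]

/-- There is a homomorphism `s` such that `L_μ^(s(μ)) ≠ 0` for all reduced roots `μ`. -/
theorem exists_hom [CharZero F] (h𝓛 : IsGeneralLieTorus R 𝓛) (hR : R.IsIrreducible) :
    ∃ s : R.rootLattice →+ G, ∀ μ : R.rootLattice, (μ : V) ∈ R.redRoots → 𝓛 μ (s μ) ≠ ⊥ := by
  obtain ⟨b⟩ := hR.exists_invariantForm
  obtain ⟨B, hB⟩ := hR.exists_isReflectableBase
  have hBl : ∀ β : B, (β : V) ∈ R.rootLattice := fun β =>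
    AddSubgroup.subset_closure (hB.subset_redRoots β.2).1
  choose g hg using fun β : B => h𝓛.exists_ne_bot (μ := ⟨β, hBl β⟩) (hB.subset_redRoots β.2).1
  obtain ⟨s, hs⟩ := hB.exists_hom g
  refine ⟨s, fun μ hμ => ?_⟩
  have key : (μ : V) ∈ {v : V | ∃ hv : v ∈ R.rootLattice, 𝓛 ⟨v, hv⟩ (s ⟨v, hv⟩) ≠ ⊥} := by
    refine hB.mem_of_isReflClosed _ ?_ ?_ μ hμ Submodule.mem_top
    · rintro α β ⟨h1, h2⟩ ⟨h3, h4⟩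
      have := h𝓛.reflection_ne_bot b (μ := ⟨α, h1⟩) α.2 h2 h4
      rw [← map_zsmul, ← map_sub] at this
      have e : ((⟨β, h3⟩ - R.cartanInt ⟨β, h3⟩ α • ⟨α, h1⟩ : R.rootLattice) : V) =
          β - R.coroot α β • (α : V) := by
        rw [AddSubgroup.coe_sub, AddSubgroup.coe_zsmul, ← Int.cast_smul_eq_zsmul ℝ,
          R.cartanInt_cast]
      rw [← e]
      exact ⟨Subtype.property _, this⟩
    · intro v hv
      refine ⟨hBl ⟨v, hv⟩, ?_⟩
      rw [hs ⟨v, hv⟩ _ rfl]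
      exact hg ⟨v, hv⟩
  obtain ⟨h1, h2⟩ := key
  exact h2

/-- An isotope, graded by the group that its support generates, is again a Lie torus. -/
theorem isotope_closure (h𝓛 : IsGeneralLieTorus R 𝓛) (s : R.rootLattice →+ G) :
    IsGeneralLieTorus R fun (α : R.rootLattice)
      (p : AddSubgroup.closure (suppG (isotope 𝓛 s))) => isotope 𝓛 s α (p : G) := by
  classical
  set P := AddSubgroup.closure (suppG (isotope 𝓛 s)) with hP
  -- Restricting the degrees to `P` therefore discards only zero components.
  have hsupp : ∀ (α : R.rootLattice) (g : G), 𝓛 α g ≠ ⊥ → g - s α ∈ P := by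
    intro α g hg
    refine AddSubgroup.subset_closure ⟨α, ?_⟩
    rwa [isotope, sub_add_cancel]
  refine ⟨fun μ g h1 h2 => h𝓛.eq_bot _ _ h1 h2, ?_, ?_, ?_, ?_, ?_, ?_, ?_⟩
  · have hint : DirectSum.IsInternal (fun p : R.rootLattice × G => 𝓛 p.1 p.2) := by
      convert h𝓛.isInternal
    have hinj : Function.Injective fun p : R.rootLattice × P => (p.1, (p.2 : G) + s p.1) := by
      rintro ⟨α, p⟩ ⟨β, q⟩ h
      simp only [Prod.mk.injEq] at h
      obtain ⟨rfl, h⟩ := h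
      rw [add_left_inj] at h
      rw [Subtype.ext h]
    have : DirectSum.IsInternal
        (fun p : R.rootLattice × P => isotope 𝓛 s p.1 ((p.2 : P) : G)) := by
      rw [DirectSum.isInternal_submodule_iff_iSupIndep_and_iSup_eq_top] at hint ⊢
      refine ⟨hint.1.comp hinj, ?_⟩
      rw [← top_le_iff, ← hint.2]
      refine iSup_le fun q => ?_
      by_cases hq : 𝓛 q.1 q.2 = ⊥
      · rw [hq]; exact bot_le
      · refine le_iSup_of_le (q.1, ⟨q.2 - s q.1, hsupp _ _ hq⟩) ?_
        simp [isotope]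
    convert this
  · intro μ ν h1 h2 h3 g h x hx y hy
    have := h𝓛.lie_mem μ ν h1 h2 h3 _ _ x hx y hy
    simp only [isotope, AddSubgroup.coe_add, map_add]
    rwa [add_add_add_comm]
  · intro p
    simp only [isotope, map_zero, add_zero]
    rw [h𝓛.zero_eq]
    refine iSup_congr fun μ => iSup_congr fun hμ => le_antisymm (iSup_le fun g => ?_)
      (iSup_le fun q => ?_)
    · by_cases hg : 𝓛 μ g = ⊥
      · refine Submodule.span_le.2 ?_
        rintro _ ⟨x, hx, y, hy, rfl⟩
        rw [hg, Submodule.mem_bot] at hx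
        rw [hx, zero_lie]
        exact Submodule.zero_mem _
      · refine le_iSup_of_le ⟨g - s μ, hsupp μ g hg⟩ (le_of_eq ?_)
        simp only [sub_add_cancel, AddSubgroup.coe_sub, map_neg]
        rw [show (p : G) - (g - s μ) + -s μ = p - g by abel]
    · refine le_iSup_of_le ((q : G) + s μ) (le_of_eq ?_)
      simp only [AddSubgroup.coe_sub, map_neg]
      rw [show (p : G) - q + -s μ = p - (q + s μ) by abel]
  · intro μ hμ p x hx hx0
    obtain ⟨y, hy, h⟩ := h𝓛.division μ hμ _ x hx hx0
    refine ⟨y, ?_, fun ν hν q z hz => h ν hν _ z hz⟩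
    simp only [isotope, AddSubgroup.coe_neg, map_neg]
    rwa [← neg_add]
  · have : suppG (fun (α : R.rootLattice) (p : P) => isotope 𝓛 s α (p : G)) =
        (Subtype.val ⁻¹' suppG (isotope 𝓛 s) : Set P) := rfl
    rw [this]
    exact AddSubgroup.closure_closure_coe_preimage
  · exact fun μ hμ p => h𝓛.rank_le_one μ hμ _
  · intro μ hμ hbot
    obtain ⟨g, hg⟩ := h𝓛.exists_ne_bot hμ
    have := iSup_eq_bot.1 hbot ⟨g - s μ, hsupp μ g hg⟩
    simp only [isotope, sub_add_cancel] at this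
    exact hg this

end IsGeneralLieTorus

end LieTorus

theorem mainTheorem1 {F : Type*} [Field F] [CharZero F]
    {V : Type*} [AddCommGroup V] [Module ℝ V]
    (R : LocallyFiniteRootSystem V) (hR : R.IsIrreducible)
    {G : Type*} [AddCommGroup G]
    {L : Type*} [LieRing L] [LieAlgebra F L]
    (𝓛 : R.rootLattice → G → Submodule F L) (h𝓛 : IsGeneralLieTorus R 𝓛) :
    ∃ (P : AddSubgroup G) (𝓛' : R.rootLattice → P → Submodule F L),
      IsIsotopicTo 𝓛 P 𝓛' ∧ IsNormalLieTorus R 𝓛' := by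
  obtain ⟨s, hs⟩ := h𝓛.exists_hom hR
  refine ⟨AddSubgroup.closure (suppG (isotope 𝓛 s)), fun α p => isotope 𝓛 s α (p : G),
    ⟨s, rfl, fun _ _ => rfl⟩, h𝓛.isotope_closure s, fun μ hμ => ?_⟩
  have hle := h𝓛.rank_le_one μ hμ.1 (s μ)
  have hpos : 1 ≤ Module.rank F (𝓛 μ (s μ)) := by
    rw [Cardinal.one_le_iff_ne_zero]
    intro h0
    have := rank_zero_iff.1 h0
    exact hs μ hμ ((Submodule.subsingleton_iff_eq_bot).1 this)
  have := le_antisymm hle hpos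
  rw [← zero_add (s μ)] at this
  exact this
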